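/- Let $\wp$ be the Weierstrass function of a period lattice $\Lambda\subset\mathbb C$, let $b_1,\dots,b_8\in\mathbb C$, $\lambda=\tfrac12\sum_{i=1}^8 b_i$, $c_i=b_i+t$, $d_i=t-b_i$, $\bar t=t+\lambda$. Matrices $\begin{pmatrix}a&b\\c&d\end{pmatrix}$ act on $\mathbb P^1$ by $z\mapsto\frac{az+b}{cz+d}$. Put $$M(h,\kappa_1,\kappa_2,s)=\begin{pmatrix}-\wp(2s-\frac{-\kappa_1+\kappa_2}2)&\wp(2s-\frac{\kappa_1-\kappa_2}2)\\-1&1\end{pmatrix}\begin{pmatrix}A&0\\0&D\end{pmatrix}\begin{pmatrix}1&-\wp(2s-\kappa_1)\\1&-\wp(2s-\kappa_2)\end{pmatrix},$$ $$A=(h-\wp(\kappa_2))\,(\wp(2s)-\wp(2s-\kappa_2))\,\bigl(\wp(2s-\tfrac{\kappa_1+\kappa_2}2)-\wp(2s-\tfrac{\kappa_1-\kappa_2}2)\bigr),$$ $$D=(h-\wp(\kappa_1))\,(\wp(2s)-\wp(2s-\kappa_1))\,\bigl(\wp(2s-\tfrac{\kappa_1+\kappa_2}2)-\wp(2s-\tfrac{-\kappa_1+\kappa_2}2)\bigr),$$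 $$N(h,\kappa,t)=M\bigl(h,\kappa_7,\kappa_8,t-\tfrac14\textstyle\sum_{i\le6}\kappa_i\bigr)\,M\bigl(h,\kappa_5,\kappa_6,t-\tfrac14\sum_{i\le4}\kappa_i\bigr)\,M\bigl(h,\kappa_3,\kappa_4,t-\tfrac14(\kappa_1+\kappa_2)\bigr)\,M(h,\kappa_1,\kappa_2,t).$$ The equation $dP(A_0^{(1)})$ for $(f(t),g(t))\in\mathbb P^1\times\mathbb P^1$ is $$g(t+\lambda)=N(f(t),c,t)\,g(t),\qquad f(t-\lambda)=N(g(t),d,t)\,f(t);$$ it is required at all times $t$ at which $(f(t),g(t))$ is not one of the eight points $p_i(t)=(\wp(b_i+t),\wp(t-b_i))$, where both right-hand sides have the form $0/0$. Consider further the system of the two determinant equations $$\begin{vmatrix}fg&g&f&1\\ \wp(b_1+t)\wp(t-b_1)&\wp(t-b_1)&\wp(b_1+t)&1\\ \wp(b_3+t)\wp(t-b_3)&\wp(t-b_3)&\wp(b_3+t)&1\\ \wp(b_5+t)\wp(t-b_5)&\wp(t-b_5)&\wp(b_5+t)&1\end{vmatrix}=0,\qquad \begin{vmatrix}f\bar g&\bar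 g&f&1\\ \wp(b_8+t)\wp(\bar t-b_8)&\wp(\bar t-b_8)&\wp(b_8+t)&1\\ \wp(b_6+t)\wp(\bar t-b_6)&\wp(\bar t-b_6)&\wp(b_6+t)&1\\ \wp(b_4+t)\wp(\bar t-b_4)&\wp(\bar t-b_4)&\wp(b_4+t)&1\end{vmatrix}=0,$$ where $f=f(t)$, $g=g(t)$, $\bar g=g(t+\lambda)$; let $I_t(f,g)$ be the first determinant. Equations are read in homogeneous coordinates when $f$ or $g$ is $\infty$. Let $t$ range over a set $T\subset\mathbb C$ with $T\pm\lambda\subset T$ such that for all $t\in T$ the points $p_1(t),\dots,p_8(t)$ are finite, with pairwise distinct first coordinates and pairwise distinct second coordinates. Call $M(h,\kappa_1,\kappa_2,s)$ regular if none of its $\wp$ is evaluated at a lattice point and $\det M\ne0$ for some $h\in\mathbb C$, and call $N$ regular if its four factors are. (1) For each $t\in T$ the determinant equations are equivalent to $f=F(t)g$ and $\bar g=G(t)f$ with explicit invertible $2\times2$ matrices $F(t),G(t)$ whose entries are $3\times 3$ minors of the determinants. If $\lambda\ne0$, then $f,g$ solve the system on $T$ if and only if there is a solution $v=(g_1,g_2)$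 on $T$, nowhere zero, of the linear equation $v(t+\lambda)=G(t)F(t)v(t)$ with $g=g_1/g_2$ and $f=Fg$ on $T$. Suppose now that $b_1+b_3+b_5+b_7=0$. (2) If $N(\cdot,c,t)$ and $N(\cdot,d,t)$ are regular for all $t\in T$, then every solution $(f,g)$ of the determinant system on $T$ is a solution of $dP(A_0^{(1)})$ on $T$. (3) Let $t\in T$. (a) If $N(\cdot,c,t)$ is regular, then among the points $p_i(t)$ exactly $p_1,p_3,p_5,p_7$ lie on the curve $I_t=0$, the graph of a Möbius transformation (so that its class on the blow-up of $\mathbb P^1\times\mathbb P^1$ at the $p_i$ is $H_0+H_1-E_1-E_3-E_5-E_7$). (b) The curve is preserved by $w_2$: put $k=\frac{2t+b_1+b_2}4$, $\tilde b_i=b_i-3k$ for $i=1,2$, $\tilde b_i=b_i+k$ for $i\ge3$, $\tilde t=t-k$; if $M(\cdot,c_1,c_2,t)$ is regular, the eight points for $(\tilde b,\tilde t)$ satisfy the conditions required above of the $p_i(t)$, and $f\ne\wp(c_1),\wp(c_2)$, then $I_t(f,g)=0$ if and only if $I(f,\tilde g)=0$ for the parameters $(\tilde b,\tilde t)$, where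 $\tilde g=M(f,c_1,c_2,t)g$. (c) The curve is preserved by the translation: if $N(\cdot,c,t)$ and $N(\cdot,d,\cdot)$ at time $\bar t$ are regular, and $(f,g),(\bar f,\bar g)$ satisfy $\bar g=N(f,c,t)g$ and $f=N(\bar g,(\bar t-b_i)_i,\bar t)\bar f$, where $f\ne\wp(b_i+t)$ and $\bar g\ne\wp(\bar t-b_i)$ for all $i$, then $I_t(f,g)=0$ if and only if $I_{\bar t}(\bar f,\bar g)=0$. -/

import Mathlib

open OnePoint

noncomputable section

namespace EllipticPainleve

/-- Homogeneous coordinates of a point of the projective line `ℙ¹ = ℂ ∪ {∞}`. -/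
def hom : OnePoint ℂ → Fin 2 → ℂ
  | ∞ => ![1, 0]
  | (z : ℂ) => ![z, 1]

/-- The vector `v` is nonzero and is a vector of homogeneous coordinates of `z`. -/
def Represents (v : Fin 2 → ℂ) (z : OnePoint ℂ) : Prop :=
  ∃ c : ℂ, c ≠ 0 ∧ v = c • hom z

/-- `w = N z`, where `N = (a b; c d)` acts by `z ↦ (a z + b) / (c z + d)`; this includes the claim
that the right-hand side is defined (that is, not of the form `0 / 0`). -/
def MobiusMap (N : Matrix (Fin 2) (Fin 2) ℂ) (z w : OnePoint ℂ) : Prop :=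
  Represents (N.mulVec (hom z)) w

/-- The matrix `M(h, κ₁, κ₂, s)`. For finite `h` the factors `hom h 0 - ℘(κ) * hom h 1` are
`h - ℘(κ)`; for `h = ∞` the common factor `h` of the matrix has been divided out. -/
def M (L : PeriodPair) (h : OnePoint ℂ) (κ₁ κ₂ s : ℂ) : Matrix (Fin 2) (Fin 2) ℂ :=
  !![-L.weierstrassP (2 * s - (-κ₁ + κ₂) / 2), L.weierstrassP (2 * s - (κ₁ - κ₂) / 2); -1, 1] *
  !![(hom h 0 - L.weierstrassP κ₂ * hom h 1) *
        (L.weierstrassP (2 * s) - L.weierstrassP (2 * s - κ₂)) *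
        (L.weierstrassP (2 * s - (κ₁ + κ₂) / 2) - L.weierstrassP (2 * s - (κ₁ - κ₂) / 2)), 0;
     0, (hom h 0 - L.weierstrassP κ₁ * hom h 1) *
        (L.weierstrassP (2 * s) - L.weierstrassP (2 * s - κ₁)) *
        (L.weierstrassP (2 * s - (κ₁ + κ₂) / 2) - L.weierstrassP (2 * s - (-κ₁ + κ₂) / 2))] *
  !![1, -L.weierstrassP (2 * s - κ₁); 1, -L.weierstrassP (2 * s - κ₂)]

/-- `M(h, κ₁, κ₂, s)` is meaningful: no `℘` in it is evaluated at a pole, and it is an invertible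
matrix for some (equivalently, for all but two) `h`. -/
structure MRegular (L : PeriodPair) (κ₁ κ₂ s : ℂ) : Prop where
  k₁ : κ₁ ∉ L.lattice
  k₂ : κ₂ ∉ L.lattice
  s₀ : 2 * s ∉ L.lattice
  s₁ : 2 * s - κ₁ ∉ L.lattice
  s₂ : 2 * s - κ₂ ∉ L.lattice
  s₃ : 2 * s - (κ₁ + κ₂) / 2 ∉ L.lattice
  s₄ : 2 * s - (κ₁ - κ₂) / 2 ∉ L.lattice
  s₅ : 2 * s - (-κ₁ + κ₂) / 2 ∉ L.lattice
  det : ∃ h : ℂ, (M L (h : OnePoint ℂ) κ₁ κ₂ s).det ≠ 0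

/- The eight parameters `b₁, …, b₈` (and `κ₁, …, κ₈`) are `b 0, …, b 7`. -/

/-- The third argument of the factors of the chain:
`t`, `t - (κ₁ + κ₂) / 4`, `t - (κ₁ + ⋯ + κ₄) / 4`, `t - (κ₁ + ⋯ + κ₆) / 4` for `j = 0, 1, 2, 3`. -/
def stage (κ : Fin 8 → ℂ) (t : ℂ) (j : ℕ) : ℂ :=
  t - (1 / 4) * ∑ i : Fin 8, if (i : ℕ) < 2 * j then κ i else 0

/-- The product of four matrices `M` on the right-hand sides of the discrete Painlevé equation. -/
def chain (L : PeriodPair) (h : OnePoint ℂ) (κ : Fin 8 → ℂ) (t : ℂ) :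
    Matrix (Fin 2) (Fin 2) ℂ :=
  M L h (κ 6) (κ 7) (stage κ t 3) * M L h (κ 4) (κ 5) (stage κ t 2) *
    M L h (κ 2) (κ 3) (stage κ t 1) * M L h (κ 0) (κ 1) (stage κ t 0)

/-- The four factors of `chain` are meaningful. -/
def ChainRegular (L : PeriodPair) (κ : Fin 8 → ℂ) (t : ℂ) : Prop :=
  MRegular L (κ 0) (κ 1) (stage κ t 0) ∧ MRegular L (κ 2) (κ 3) (stage κ t 1) ∧
    MRegular L (κ 4) (κ 5) (stage κ t 2) ∧ MRegular L (κ 6) (κ 7) (stage κ t 3)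

/-- `cᵢ = bᵢ + t`. -/
def cpar (b : Fin 8 → ℂ) (t : ℂ) (i : Fin 8) : ℂ := b i + t

/-- `dᵢ = t - bᵢ`. -/
def dpar (b : Fin 8 → ℂ) (t : ℂ) (i : Fin 8) : ℂ := t - b i

/-- The step `λ` of the difference equation. -/
def lam (b : Fin 8 → ℂ) : ℂ := (1 / 2) * ∑ i, b i

/-- The point `(℘(bᵢ + t), ℘(u - bᵢ))`. For `u = t` it is the blown-up point `pᵢ`. -/
def pt (L : PeriodPair) (b : Fin 8 → ℂ) (t u : ℂ) (i : Fin 8) : ℂ × ℂ :=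
  (L.weierstrassP (b i + t), L.weierstrassP (u - b i))

/-- The eight points `pᵢ` at time `t` are finite, and no two of them have the same first or the
same second coordinate. -/
structure GeneralPosition (L : PeriodPair) (b : Fin 8 → ℂ) (t : ℂ) : Prop where
  add_notMem : ∀ i, b i + t ∉ L.lattice
  sub_notMem : ∀ i, t - b i ∉ L.lattice
  inj_fst : Function.Injective fun i => L.weierstrassP (b i + t)
  inj_snd : Function.Injective fun i => L.weierstrassP (t - b i)

/-- `(x, y) ∈ ℙ¹ × ℙ¹` is one of the eight points `pᵢ` at time `t`. -/
def IsBasePoint (L : PeriodPair) (b : Fin 8 → ℂ) (t : ℂ) (x y : OnePoint ℂ) : Prop :=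
  ∃ i, x = ((pt L b t t i).1 : OnePoint ℂ) ∧ y = ((pt L b t t i).2 : OnePoint ℂ)

/-- First discrete Painlevé equation at time `t`; `x`, `y`, `y'` stand for
`f(t)`, `g(t)`, `g(t + λ)`. -/
def Eq1 (L : PeriodPair) (b : Fin 8 → ℂ) (t : ℂ) (x y y' : OnePoint ℂ) : Prop :=
  MobiusMap (chain L x (cpar b t) t) y y'

/-- Second discrete Painlevé equation at time `t`; `x`, `y`, `x'` stand for
`f(t)`, `g(t)`, `f(t - λ)`. -/
def Eq2 (L : PeriodPair) (b : Fin 8 → ℂ) (t : ℂ) (x y x' : OnePoint ℂ) : Prop :=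
  MobiusMap (chain L y (dpar b t) t) x x'

/-- `(f, g)` solves the discrete Painlevé equation on the time domain `T`. At a time at which
`(f, g)` sits at one of the eight blown-up points both equations are `0 / 0` and impose nothing. -/
def IsSolution (L : PeriodPair) (b : Fin 8 → ℂ) (T : Set ℂ) (f g : ℂ → OnePoint ℂ) : Prop :=
  ∀ t ∈ T, ¬ IsBasePoint L b t (f t) (g t) →
    Eq1 L b t (f t) (g t) (g (t + lam b)) ∧ Eq2 L b t (f t) (g t) (f (t - lam b))

/-- The determinant with rows `(x y, y, x, 1)` and `(pₖ.1 pₖ.2, pₖ.2, pₖ.1, 1)`, `k = 0, 1, 2`,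
its first row being written in the homogeneous coordinates of `x` and `y`. -/
def form (p : Fin 3 → ℂ × ℂ) (x y : OnePoint ℂ) : ℂ :=
  Matrix.det
    !![hom x 0 * hom y 0, hom x 1 * hom y 0, hom x 0 * hom y 1, hom x 1 * hom y 1;
       (p 0).1 * (p 0).2, (p 0).2, (p 0).1, 1;
       (p 1).1 * (p 1).2, (p 1).2, (p 1).1, 1;
       (p 2).1 * (p 2).2, (p 2).2, (p 2).1, 1]

/-- The points `(℘(bᵢ + t), ℘(t - bᵢ))` for `i = 1, 3, 5`. -/
def oddPts (L : PeriodPair) (b : Fin 8 → ℂ) (t : ℂ) : Fin 3 → ℂ × ℂ :=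
  ![pt L b t t 0, pt L b t t 2, pt L b t t 4]

/-- The points `(℘(bᵢ + t), ℘(t + λ - bᵢ))` for `i = 8, 6, 4`. -/
def evenPts (L : PeriodPair) (b : Fin 8 → ℂ) (t : ℂ) : Fin 3 → ℂ × ℂ :=
  ![pt L b t (t + lam b) 7, pt L b t (t + lam b) 5, pt L b t (t + lam b) 3]

/-- First determinant equation, `I = 0`, at time `t`, for `x = f(t)`, `y = g(t)`. -/
def Det1 (L : PeriodPair) (b : Fin 8 → ℂ) (t : ℂ) (x y : OnePoint ℂ) : Prop :=
  form (oddPts L b t) x y = 0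

/-- Second determinant equation at time `t`, for `x = f(t)`, `y' = g(t + λ)`. -/
def Det2 (L : PeriodPair) (b : Fin 8 → ℂ) (t : ℂ) (x y' : OnePoint ℂ) : Prop :=
  form (evenPts L b t) x y' = 0

/-- `(f, g)` solves the system of the two determinant equations on the time domain `T`. -/
def IsDetSolution (L : PeriodPair) (b : Fin 8 → ℂ) (T : Set ℂ) (f g : ℂ → OnePoint ℂ) : Prop :=
  ∀ t ∈ T, Det1 L b t (f t) (g t) ∧ Det2 L b t (f t) (g (t + lam b))

/-- The `3 × 3` determinant whose rows are `(u pₖ, v pₖ, w pₖ)`, `k = 0, 1, 2`. -/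
def minor (p : Fin 3 → ℂ × ℂ) (u v w : ℂ × ℂ → ℂ) : ℂ :=
  Matrix.det (Matrix.of fun k : Fin 3 => ![u (p k), v (p k), w (p k)])

/-- The matrix of the Möbius map `y ↦ x` obtained by solving `form p x y = 0` for `x`. -/
def solveX (p : Fin 3 → ℂ × ℂ) : Matrix (Fin 2) (Fin 2) ℂ :=
  !![minor p (fun q => q.1 * q.2) (fun q => q.1) (fun _ => 1),
     minor p (fun q => q.1 * q.2) (fun q => q.2) (fun q => q.1);
     minor p (fun q => q.2) (fun q => q.1) (fun _ => 1),
     minor p (fun q => q.1 * q.2) (fun q => q.2) (fun _ => 1)]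

/-- The matrix of the Möbius map `x ↦ y` obtained by solving `form p x y = 0` for `y`. -/
def solveY (p : Fin 3 → ℂ × ℂ) : Matrix (Fin 2) (Fin 2) ℂ :=
  !![minor p (fun q => q.1 * q.2) (fun q => q.2) (fun _ => 1),
     minor p (fun q => q.1 * q.2) (fun q => q.1) (fun q => q.2);
     minor p (fun q => q.1) (fun q => q.2) (fun _ => 1),
     minor p (fun q => q.1 * q.2) (fun q => q.1) (fun _ => 1)]

/-- `f(t) = Fmat(t) g(t)`. -/
def Fmat (L : PeriodPair) (b : Fin 8 → ℂ) (t : ℂ) : Matrix (Fin 2) (Fin 2) ℂ :=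
  solveX (oddPts L b t)

/-- `g(t + λ) = Gmat(t) f(t)`. -/
def Gmat (L : PeriodPair) (b : Fin 8 → ℂ) (t : ℂ) : Matrix (Fin 2) (Fin 2) ℂ :=
  solveY (evenPts L b t)

/-- The parameters `b` after the reflection `w₂`. -/
def w2b (b : Fin 8 → ℂ) (t : ℂ) (i : Fin 8) : ℂ :=
  if (i : ℕ) < 2 then b i - 3 * ((2 * t + b 0 + b 1) / 4) else b i + (2 * t + b 0 + b 1) / 4

/-- The variable `t` after the reflection `w₂`. -/
def w2t (b : Fin 8 → ℂ) (t : ℂ) : ℂ := t - (2 * t + b 0 + b 1) / 4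

end EllipticPainleve

end

open EllipticPainleve

/-! Everything takes place on the curve `u ↦ (℘(u), ℘(2s - u))` in `ℙ¹ × ℙ¹`. For `s = t` the
parameters `u = cᵢ` give the points `pᵢ(t)`. The Weierstrass identity `℘(a) - ℘(b) = -σ(a+b)σ(a-b) /
(σ(a)²σ(b)²)`, proved from the product for `σ` and Liouville's theorem, makes determinants of
suitably normalized homogeneous coordinates of `℘` into products of two values of `σ`, also at the
poles (`br_sigmaVec`). The Plücker relation then becomes the three-term relation of `σ`.

From it follows `exists_onGraph_iff`: a Möbius graph drawn through three points of the curve meets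
the curve at one further parameter, and the four parameters add up to `4s` modulo the lattice. As
`c₁ + c₃ + c₅ + c₇ = 4t + (b₁ + b₃ + b₅ + b₇)`, the condition on `b` says that the graph through
`p₁`, `p₃`, `p₅` also contains `p₇`.

For `h = ℘(u)` the matrix `M(h, κ₁, κ₂, s)` sends `℘(2s - u)` to `℘(2s' - u)` with `s' = s - (κ₁ +
κ₂)/4`. Applied fibrewise to a Möbius graph through the point with parameter `κ₁` but not through
that with `κ₂`, it yields a vector quadratic in `h` which is divisible by `h - ℘(κ₁)`; the quotient
is again a Möbius graph. The new graph loses the point `κ₁`, gains `-κ₂`, and keeps the other points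
of the curve (`exists_reflected_graph`). Four such steps turn the graph through the points with
parameters `c₁, c₃, c₅, c₇` into the one through the points with parameters `-c₂, -c₄, -c₆, -c₈`,
which is the second determinant equation. This gives the first Painlevé equation; exchanging the
coordinates gives the other (`form_endPts_iff_mobiusMap_chain`). Invariance under `w₂` is one step
of the argument, and invariance under translation is two chains meeting at the second determinant
equation.

The linearization does not use the elliptic structure: homogeneous coordinates of a solution satisfy
the linear equation up to a scalar, and a scalar difference equation removes it. -/

noncomputable section

namespace PeriodPair

open Filter Topology

variable (L : PeriodPair)

/-! ### The Weierstrass product for `σ` -/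

/-- The factor of the Weierstrass product of `σ` at the lattice point `l`. At `l = 0` it is `1`. -/
def sigmaFactor (l z : ℂ) : ℂ := (1 - z / l) * Complex.exp (z / l + (z / l) ^ 2 / 2)

/-- The exponent cancels the logarithm of `1 - w` to second order, so the derivative is `-w² exp(w +
w²/2)`; the mean value inequality then gives a cubic bound, enough for convergence over a lattice of
rank two. -/
lemma norm_one_sub_mul_exp_sub_one_le {w : ℂ} (hw : ‖w‖ ≤ 1) :
    ‖(1 - w) * Complex.exp (w + w ^ 2 / 2) - 1‖ ≤ 8 * ‖w‖ ^ 3 := by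
  have hd : ∀ x ∈ Metric.closedBall (0 : ℂ) ‖w‖,
      HasDerivWithinAt (fun w : ℂ => (1 - w) * Complex.exp (w + w ^ 2 / 2))
        (-x ^ 2 * Complex.exp (x + x ^ 2 / 2)) (Metric.closedBall (0 : ℂ) ‖w‖) x := by
    intro x _
    have h1 : HasDerivAt (fun w : ℂ => w + w ^ 2 / 2) (1 + x) x := by
      convert! (hasDerivAt_id x).add (((hasDerivAt_id x).pow 2).div_const 2) using 1
      simp
    convert! (((hasDerivAt_id x).const_sub 1).mul h1.cexp).hasDerivWithinAt using 1
    simp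
    ring
  have hb : ∀ x ∈ Metric.closedBall (0 : ℂ) ‖w‖,
      ‖-x ^ 2 * Complex.exp (x + x ^ 2 / 2)‖ ≤ 8 * ‖w‖ ^ 2 := by
    intro x hx
    have hx' : ‖x‖ ≤ ‖w‖ := by simpa using hx
    have h0 : ‖x + x ^ 2 / 2‖ ≤ 2 := by
      calc ‖x + x ^ 2 / 2‖ ≤ ‖x‖ + ‖x ^ 2 / 2‖ := norm_add_le _ _
        _ = ‖x‖ + ‖x‖ ^ 2 / 2 := by simp
        _ ≤ 2 := by nlinarith [norm_nonneg x]
    have h1 : ‖Complex.exp (x + x ^ 2 / 2)‖ ≤ 8 := by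
      refine (Complex.norm_exp_le_exp_norm _).trans ((Real.exp_le_exp.mpr h0).trans ?_)
      have := Real.exp_one_lt_d9
      have h2 : Real.exp 2 = Real.exp 1 * Real.exp 1 := by rw [← Real.exp_add]; norm_num
      rw [h2]
      nlinarith [Real.exp_pos 1]
    rw [norm_mul, norm_neg, norm_pow, mul_comm]
    gcongr
  have := (convex_closedBall (0 : ℂ) ‖w‖).norm_image_sub_le_of_norm_hasDerivWithin_le hd hb
    (x := 0) (y := w) (by simp) (by simp)
  simpa [pow_succ, mul_assoc] using this

lemma norm_sigmaFactor_sub_one_le {r : ℝ} {l z : ℂ} (hr : 0 < r) (hz : ‖z‖ < r) (hl : r ≤ ‖l‖) :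
    ‖sigmaFactor l z - 1‖ ≤ 8 * r ^ 3 * ‖l‖ ^ (-3 : ℝ) := by
  have hl0 : 0 < ‖l‖ := hr.trans_le hl
  have h1 : ‖z / l‖ ≤ r / ‖l‖ := by rw [norm_div]; gcongr
  have h2 : ‖z / l‖ ≤ 1 := h1.trans ((div_le_one hl0).mpr hl)
  refine (norm_one_sub_mul_exp_sub_one_le h2).trans ?_
  calc 8 * ‖z / l‖ ^ 3 ≤ 8 * (r / ‖l‖) ^ 3 := by gcongr
    _ = 8 * r ^ 3 * ‖l‖ ^ (-3 : ℝ) := by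
      rw [Real.rpow_neg hl0.le, div_pow]; norm_cast; ring

lemma summable_rpow_neg_three (c : ℝ) :
    Summable fun l : L.lattice => c * ‖(l : ℂ)‖ ^ (-3 : ℝ) :=
  (ZLattice.summable_norm_rpow _ _ (by simp; norm_num)).mul_left _

lemma eventually_le_norm (r : ℝ) : ∀ᶠ l : L.lattice in cofinite, r ≤ ‖(l : ℂ)‖ := by
  refine (isCompact_iff_finite.mp (isCompact_closedBall (0 : L.lattice) r)).subset ?_
  intro l hl
  simp only [Set.mem_compl_iff, Set.mem_ofPred_eq, not_le] at hl
  simpa using hl.le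

lemma differentiable_sigmaFactor (l : ℂ) : Differentiable ℂ (sigmaFactor l) := by
  unfold sigmaFactor
  fun_prop

lemma hasProdLocallyUniformlyOn_sigmaFactor {r : ℝ} (hr : 0 < r) :
    HasProdLocallyUniformlyOn (fun (l : L.lattice) z => sigmaFactor l z)
      (fun z => ∏' l : L.lattice, sigmaFactor l z) (Metric.ball (0 : ℂ) r) := by
  have := Summable.hasProdLocallyUniformlyOn_one_add (R := ℂ) (Metric.isOpen_ball (x := (0 : ℂ)) (ε := r))
    (L.summable_rpow_neg_three (8 * r ^ 3)) (f := fun (l : L.lattice) z => sigmaFactor l z - 1)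
    (by
      filter_upwards [L.eventually_le_norm r] with l hl z hz
      exact norm_sigmaFactor_sub_one_le hr (by simpa using hz) hl)
    (fun l => ((differentiable_sigmaFactor l).sub_const 1).continuous.continuousOn)
  simpa using this

/-- The Weierstrass `σ` function divided by `z`. -/
def sigmaProd (z : ℂ) : ℂ := ∏' l : L.lattice, sigmaFactor l z

lemma differentiable_sigmaProd : Differentiable ℂ L.sigmaProd := by
  intro z
  have hr : 0 < ‖z‖ + 1 := by positivity
  have := (L.hasProdLocallyUniformlyOn_sigmaFactor hr).differentiableOn
    (.of_forall fun s => by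
      simpa [Finset.prod_fn] using DifferentiableOn.finsetProd
        (s := Metric.ball (0 : ℂ) (‖z‖ + 1)) (u := s) (f := fun (l : L.lattice) z => sigmaFactor l z)
        (fun l _ => (differentiable_sigmaFactor (l : ℂ)).differentiableOn)) Metric.isOpen_ball
  exact this.differentiableAt (Metric.isOpen_ball.mem_nhds (by simp))

lemma sigmaFactor_eq_zero_iff {l z : ℂ} : sigmaFactor l z = 0 ↔ l ≠ 0 ∧ z = l := by
  rcases eq_or_ne l 0 with rfl | hl
  · simp [sigmaFactor]
  · simp only [sigmaFactor, mul_eq_zero, Complex.exp_ne_zero, or_false, sub_eq_zero,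
      eq_div_iff hl, one_mul, ne_eq, hl, not_false_eq_true, true_and]
    exact eq_comm

lemma sigmaProd_ne_zero {z : ℂ} (h : ∀ l ∈ L.lattice, l ≠ 0 → z ≠ l) : L.sigmaProd z ≠ 0 := by
  have hr : 0 < ‖z‖ + 1 := by positivity
  have := tprod_one_add_ne_zero_of_summable (f := fun l : L.lattice => sigmaFactor l z - 1)
    (fun l => by
      simp only [add_sub_cancel, ne_eq, sigmaFactor_eq_zero_iff, not_and]
      exact h l l.2)
    (Summable.of_norm_bounded_eventually (L.summable_rpow_neg_three (8 * (‖z‖ + 1) ^ 3)) (by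
      filter_upwards [L.eventually_le_norm (‖z‖ + 1)] with l hl
      simpa using norm_sigmaFactor_sub_one_le hr (by simp) hl))
  simpa [sigmaProd] using this

/-- The Weierstrass `σ` function. -/
def sigma (z : ℂ) : ℂ := z * L.sigmaProd z

lemma sigma_eq_zero_iff {z : ℂ} : L.sigma z = 0 ↔ z ∈ L.lattice := by
  constructor
  · intro h
    by_contra hz
    refine mul_ne_zero ?_ (L.sigmaProd_ne_zero ?_) h
    · rintro rfl; exact hz (zero_mem _)
    · rintro l hl - rfl; exact hz hl
  · intro h
    rcases eq_or_ne z 0 with rfl | hz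
    · simp [sigma]
    · have : L.sigmaProd z = 0 :=
        tprod_of_exists_eq_zero ⟨⟨z, h⟩, sigmaFactor_eq_zero_iff.mpr ⟨hz, rfl⟩⟩
      simp [sigma, this]

lemma sigmaProd_neg (z : ℂ) : L.sigmaProd (-z) = L.sigmaProd z := by
  simp only [sigmaProd]
  rw [← (Equiv.neg L.lattice).tprod_eq]
  congr with l
  simp [sigmaFactor]

lemma sigma_neg (z : ℂ) : L.sigma (-z) = -L.sigma z := by
  simp [sigma, sigmaProd_neg]

lemma sigmaProd_zero : L.sigmaProd 0 = 1 := by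
  simp [sigmaProd, sigmaFactor]

lemma differentiable_sigma : Differentiable ℂ L.sigma :=
  differentiable_id.mul L.differentiable_sigmaProd

/-! ### The `ζ` function and quasi-periodicity of `σ` -/

/-- The term of the Weierstrass `ζ` function at `l ≠ 0`. -/
def zetaTerm (l z : ℂ) : ℂ := if l = 0 then 0 else 1 / (z - l) + 1 / l + z / l ^ 2

lemma logDeriv_sigmaFactor {l z : ℂ} (hz : z ≠ l) : logDeriv (sigmaFactor l) z = zetaTerm l z := by
  rcases eq_or_ne l 0 with rfl | hl
  · have : sigmaFactor 0 = fun _ => 1 := by ext; simp [sigmaFactor]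
    simp [this, zetaTerm, logDeriv]
  · have h1 : HasDerivAt (fun z => z / l + (z / l) ^ 2 / 2) (1 / l + z / l ^ 2) z := by
      convert! ((hasDerivAt_id z).div_const l).add
        ((((hasDerivAt_id z).div_const l).pow 2).div_const 2) using 1
      simp
      field_simp
    have h2 := (((hasDerivAt_id z).div_const l).const_sub 1).mul h1.cexp
    have h3 : HasDerivAt (sigmaFactor l) _ z := h2
    have h4 : z - l ≠ 0 := sub_ne_zero.mpr hz
    have h5 : l - z ≠ 0 := sub_ne_zero.mpr hz.symm
    rw [logDeriv_apply, h3.deriv, zetaTerm, if_neg hl, sigmaFactor]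
    have := Complex.exp_ne_zero (z / l + (z / l) ^ 2 / 2)
    simp only [id]
    field_simp
    ring

lemma hasSumLocallyUniformly_zetaTerm :
    HasSumLocallyUniformly (fun (l : L.lattice) z => zetaTerm l z)
      (fun z => ∑' l : L.lattice, zetaTerm l z) := by
  refine L.hasSumLocallyUniformly_aux (u := fun r l => 2 * r ^ 2 * ‖(l : ℂ)‖ ^ (-3 : ℝ)) _
    (fun r _ => L.summable_rpow_neg_three _) fun r hr =>
    Filter.eventually_atTop.mpr ⟨2 * r, ?_⟩
  rintro _ h z hz l rfl
  have hl0 : 0 < ‖(l : ℂ)‖ := by linarith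
  have hl : (l : ℂ) ≠ 0 := norm_pos_iff.mp hl0
  have h1 : ‖(l : ℂ)‖ / 2 ≤ ‖z - l‖ := by
    rw [norm_sub_rev]
    exact .trans (by linarith) (norm_sub_norm_le _ z)
  have h2 : z - l ≠ 0 := norm_pos_iff.mp (by linarith)
  -- Combining the fractions exhibits the cubic decay in `l`.
  have h3 : zetaTerm l z = z ^ 2 / (l ^ 2 * (z - l)) := by
    rw [zetaTerm, if_neg hl]
    field_simp
    ring
  rw [h3, norm_div, norm_mul, norm_pow, norm_pow]
  calc ‖z‖ ^ 2 / (‖(l : ℂ)‖ ^ 2 * ‖z - l‖) ≤ r ^ 2 / (‖(l : ℂ)‖ ^ 2 * (‖(l : ℂ)‖ / 2)) := by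
        gcongr
    _ = 2 * r ^ 2 * ‖(l : ℂ)‖ ^ (-3 : ℝ) := by
      rw [Real.rpow_neg hl0.le]
      norm_cast
      field_simp

lemma hasDerivAt_zetaTerm {l z : ℂ} (hz : z ≠ l) :
    HasDerivAt (zetaTerm l) (-(if l = 0 then 0 else (1 / (z - l) ^ 2 - 1 / l ^ 2))) z := by
  rcases eq_or_ne l 0 with rfl | hl
  · have : zetaTerm 0 = fun _ => 0 := by ext; simp [zetaTerm]
    simpa [this] using hasDerivAt_const z (0 : ℂ)
  · have h2 : z - l ≠ 0 := sub_ne_zero.mpr hz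
    have : zetaTerm l = fun z => 1 / (z - l) + 1 / l + z / l ^ 2 := by ext; simp [zetaTerm, hl]
    rw [this, if_neg hl]
    convert! (((hasDerivAt_const z (1 : ℂ)).div ((hasDerivAt_id z).sub_const l) h2).add_const
      (1 / l)).add ((hasDerivAt_id z).div_const (l ^ 2)) using 1
    simp
    field_simp
    ring

/-- The Weierstrass `ζ` function. -/
def zeta (z : ℂ) : ℂ := 1 / z + ∑' l : L.lattice, zetaTerm l z

lemma isOpen_compl_lattice : IsOpen ((L.lattice : Set ℂ)ᶜ) := L.isClosed_lattice.isOpen_compl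

lemma ne_coe {z : ℂ} (hz : z ∉ L.lattice) (l : L.lattice) : z ≠ l := by
  rintro rfl; exact hz l.2

lemma hasDerivAt_zeta {z : ℂ} (hz : z ∉ L.lattice) : HasDerivAt L.zeta (-L.weierstrassP z) z := by
  have hd : ∀ s : Finset L.lattice, DifferentiableOn ℂ (fun z => ∑ l ∈ s, zetaTerm l z)
      (L.lattice : Set ℂ)ᶜ := fun s => DifferentiableOn.fun_sum fun l _ z hz =>
    (hasDerivAt_zetaTerm (L.ne_coe hz l)).differentiableAt.differentiableWithinAt
  have hlu := L.hasSumLocallyUniformly_zetaTerm.tendstoLocallyUniformlyOn (s := (L.lattice : Set ℂ)ᶜ)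
  have h1 : DifferentiableAt ℂ (fun z => ∑' l : L.lattice, zetaTerm l z) z :=
    (hlu.differentiableOn (.of_forall hd) L.isOpen_compl_lattice).differentiableAt
      (L.isOpen_compl_lattice.mem_nhds hz)
  have h2 : deriv (fun z => ∑' l : L.lattice, zetaTerm l z) z = -L.weierstrassPExcept 0 z := by
    have h3 := (hlu.deriv (.of_forall hd) L.isOpen_compl_lattice).tendsto_at hz
    refine tendsto_nhds_unique h3 ?_
    refine (L.hasSum_weierstrassPExcept 0 z).neg.congr fun s => ?_
    have h4 : HasDerivAt (fun z => ∑ l ∈ s, zetaTerm l z) _ z :=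
      HasDerivAt.fun_sum fun l _ => hasDerivAt_zetaTerm (L.ne_coe hz l)
    exact h4.deriv.symm
  have hz0 : z ≠ 0 := by rintro rfl; exact hz (zero_mem _)
  have h5 := ((hasDerivAt_const z (1 : ℂ)).div (hasDerivAt_id z) hz0).add h1.hasDerivAt
  rw [h2] at h5
  convert! h5 using 1
  have := L.weierstrassPExcept_def 0 z
  simp only [ZeroMemClass.coe_zero] at this
  rw [this]
  simp
  ring

lemma hasDerivAt_sigma {z : ℂ} (hz : z ∉ L.lattice) :
    HasDerivAt L.sigma (L.zeta z * L.sigma z) z := by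
  have hr : 0 < ‖z‖ + 1 := by positivity
  have hz0 : z ≠ 0 := by rintro rfl; exact hz (zero_mem _)
  have hP : L.sigmaProd z ≠ 0 := L.sigmaProd_ne_zero (by rintro l hl - rfl; exact hz hl)
  have hfun : (fun l : L.lattice => logDeriv (sigmaFactor l) z) = fun l : L.lattice => zetaTerm l z :=
    funext fun l => logDeriv_sigmaFactor (L.ne_coe hz l)
  have h := logDeriv_tprod_eq_tsum (f := fun (l : L.lattice) z => sigmaFactor l z)
    (Metric.isOpen_ball (x := (0 : ℂ)) (ε := ‖z‖ + 1)) (x := z) (by simp)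
    (fun l => by
      rw [ne_eq, sigmaFactor_eq_zero_iff]
      exact fun h => L.ne_coe hz l h.2)
    (fun l => (differentiable_sigmaFactor l).differentiableOn)
    (by
      show Summable fun l : L.lattice => logDeriv (sigmaFactor l) z
      rw [hfun]
      exact L.hasSumLocallyUniformly_zetaTerm.hasSum.summable)
    ⟨_, L.hasProdLocallyUniformlyOn_sigmaFactor hr⟩ hP
  have h' : deriv L.sigmaProd z / L.sigmaProd z = ∑' l : L.lattice, zetaTerm l z := by
    rw [← hfun]; exact h
  have h2 := (hasDerivAt_id z).mul (L.differentiable_sigmaProd z).hasDerivAt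
  convert! h2 using 1
  rw [zeta, ← h', sigma, id]
  field_simp

/-- A countable set does not disconnect the plane. Hence a function with zero derivative off the
lattice is constant there, which is how both quasi-periodicity laws are obtained. -/
lemma isPreconnected_compl_lattice : IsPreconnected ((L.lattice : Set ℂ)ᶜ) := by
  refine (Set.Countable.isConnected_compl_of_one_lt_rank ?_ ?_).isPreconnected
  · rw [Complex.rank_real_complex]; norm_num
  · exact Set.countable_coe_iff.mp (L.latticeEquivProd.injective.countable)

lemma exists_notMem_lattice : ∃ z, z ∉ L.lattice := ⟨_, L.ω₁_div_two_notMem_lattice⟩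

lemma eq_of_deriv_eq_zero_compl_lattice {f : ℂ → ℂ}
    (hf : ∀ z, z ∉ L.lattice → HasDerivAt f 0 z) :
    ∃ c, ∀ z, z ∉ L.lattice → f z = c := by
  obtain ⟨z₀, hz₀⟩ := L.exists_notMem_lattice
  refine ⟨f z₀, fun z hz => ?_⟩
  exact L.isOpen_compl_lattice.is_const_of_deriv_eq_zero L.isPreconnected_compl_lattice
    (fun z hz => (hf z hz).differentiableAt.differentiableWithinAt) (fun z hz => (hf z hz).deriv)
    hz hz₀

lemma exists_zeta_add (l : L.lattice) :
    ∃ η, ∀ z, z ∉ L.lattice → L.zeta (z + l) = L.zeta z + η := by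
  obtain ⟨η, h⟩ := L.eq_of_deriv_eq_zero_compl_lattice (f := fun z => L.zeta (z + l) - L.zeta z)
    (fun z hz => by
      have hzl : z + l ∉ L.lattice := fun h => hz (by simpa using sub_mem h l.2)
      have := ((L.hasDerivAt_zeta hzl).comp_add_const z (l : ℂ)).sub (L.hasDerivAt_zeta hz)
      simpa using! this)
  exact ⟨η, fun z hz => by rw [← h z hz]; ring⟩

/-- Quasi-periodicity of `σ`. -/
lemma exists_sigma_add (l : L.lattice) :
    ∃ C η : ℂ, C ≠ 0 ∧ ∀ z, L.sigma (z + l) = C * Complex.exp (η * z) * L.sigma z := by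
  obtain ⟨η, hη⟩ := L.exists_zeta_add l
  have hmem : ∀ z : ℂ, z + l ∈ L.lattice ↔ z ∈ L.lattice :=
    fun z => ⟨fun h => by simpa using sub_mem h l.2,
      fun h => add_mem h l.2⟩
  obtain ⟨C, hC⟩ := L.eq_of_deriv_eq_zero_compl_lattice
    -- The logarithmic derivative of this function is `ζ(z + l) - η - ζ(z) = 0`.
    (f := fun z => L.sigma (z + l) * Complex.exp (-η * z) / L.sigma z)
    (fun z hz => by
      have hzl : z + l ∉ L.lattice := fun h => hz ((hmem z).mp h)
      have hs : L.sigma z ≠ 0 := fun h => hz (L.sigma_eq_zero_iff.mp h)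
      have h1 := (L.hasDerivAt_sigma hzl).comp_add_const z (l : ℂ)
      have h2 : HasDerivAt (fun z => Complex.exp (-η * z)) _ z :=
        ((hasDerivAt_id z).const_mul (-η)).cexp
      convert! (h1.mul h2).div (L.hasDerivAt_sigma hz) hs using 1
      rw [hη z hz]
      simp
      rw [eq_div_iff (pow_ne_zero 2 hs)]
      ring)
  obtain ⟨z₀, hz₀⟩ := L.exists_notMem_lattice
  refine ⟨C, η, ?_, fun z => ?_⟩
  · rw [← hC z₀ hz₀]
    refine div_ne_zero (mul_ne_zero ?_ (Complex.exp_ne_zero _)) ?_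
    · rwa [ne_eq, L.sigma_eq_zero_iff, hmem]
    · rwa [ne_eq, L.sigma_eq_zero_iff]
  · by_cases hz : z ∈ L.lattice
    · rw [L.sigma_eq_zero_iff.mpr hz, L.sigma_eq_zero_iff.mpr ((hmem z).mpr hz), mul_zero]
    · have hs : L.sigma z ≠ 0 := fun h => hz (L.sigma_eq_zero_iff.mp h)
      rw [← hC z hz, neg_mul, Complex.exp_neg]
      have := Complex.exp_ne_zero (η * z)
      field_simp

/-! ### The factorization of `℘(a) - ℘(b)` -/

/-- `1 + σ(a + b) σ(a - b) a² / (σ(a)² σ(b)²)` as a function of `a`. -/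
def sigmaDefect (b a : ℂ) : ℂ :=
  1 + L.sigma (a + b) * L.sigma (a - b) / (L.sigmaProd a ^ 2 * L.sigma b ^ 2)

lemma differentiableOn_sigmaDefect {b : ℂ} (hb : b ∉ L.lattice) :
    DifferentiableOn ℂ (L.sigmaDefect b) ((L.lattice : Set ℂ) \ {0})ᶜ := by
  intro a ha
  have ha' : L.sigmaProd a ≠ 0 := L.sigmaProd_ne_zero (by
    rintro l hl hl0 rfl; exact ha ⟨hl, hl0⟩)
  have hs : L.sigma b ≠ 0 := fun h => hb (L.sigma_eq_zero_iff.mp h)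
  have h1 := L.differentiable_sigma
  have h2 := L.differentiable_sigmaProd
  refine DifferentiableAt.differentiableWithinAt ?_
  unfold sigmaDefect
  refine (DifferentiableAt.div (by fun_prop) (by fun_prop) ?_).const_add 1
  exact mul_ne_zero (pow_ne_zero 2 ha') (pow_ne_zero 2 hs)

lemma sigmaDefect_neg (b a : ℂ) : L.sigmaDefect b (-a) = L.sigmaDefect b a := by
  have h1 : -a + b = -(a - b) := by ring
  have h2 : -a - b = -(a + b) := by ring
  rw [sigmaDefect, sigmaDefect, h1, h2, sigma_neg, sigma_neg, sigmaProd_neg]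
  ring

lemma sigmaDefect_zero {b : ℂ} (hb : b ∉ L.lattice) : L.sigmaDefect b 0 = 0 := by
  have hs : L.sigma b ≠ 0 := fun h => hb (L.sigma_eq_zero_iff.mp h)
  rw [sigmaDefect, sigmaProd_zero, zero_sub, zero_add, sigma_neg]
  field_simp
  ring

lemma compl_lattice_sdiff_zero_mem_nhds : ((L.lattice : Set ℂ) \ {0})ᶜ ∈ 𝓝 (0 : ℂ) :=
  L.compl_lattice_sdiff_singleton_mem_nhds 0

/-- An even function has zero derivative at `0`. With `sigmaDefect_zero` this makes `0` a zero of
order at least two, which cancels the double pole in `sigmaQuot`. -/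
lemma deriv_sigmaDefect_zero {b : ℂ} (hb : b ∉ L.lattice) : deriv (L.sigmaDefect b) 0 = 0 := by
  have h := ((L.differentiableOn_sigmaDefect hb).differentiableAt
    L.compl_lattice_sdiff_zero_mem_nhds).hasDerivAt
  have h' : HasDerivAt (L.sigmaDefect b) (-deriv (L.sigmaDefect b) 0) 0 := by
    have h0 : HasDerivAt (L.sigmaDefect b) (deriv (L.sigmaDefect b) 0) (-0) := by simpa using h
    have := h0.scomp (0 : ℂ) (hasDerivAt_neg (0 : ℂ))
    convert! this using 1
    · ext a; simp [sigmaDefect_neg]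
    · simp
  exact self_eq_neg.mp (h.unique h')

/-- The function `℘(a) + σ(a + b) σ(a - b) / (σ(a)² σ(b)²)` of `a`. -/
def sigmaQuot (b a : ℂ) : ℂ :=
  L.weierstrassP a + L.sigma (a + b) * L.sigma (a - b) / (L.sigma a ^ 2 * L.sigma b ^ 2)

/-- The regular part of `sigmaQuot` at `0`. -/
def sigmaQuotReg (b a : ℂ) : ℂ :=
  L.weierstrassPExcept 0 a + dslope (dslope (L.sigmaDefect b) 0) 0 a

lemma differentiableAt_sigmaQuotReg {b : ℂ} (hb : b ∉ L.lattice) :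
    DifferentiableAt ℂ (L.sigmaQuotReg b) 0 := by
  have hn := L.compl_lattice_sdiff_zero_mem_nhds
  have h1 := (Complex.differentiableOn_dslope hn).mpr
    ((Complex.differentiableOn_dslope hn).mpr (L.differentiableOn_sigmaDefect hb))
  exact ((L.differentiableOn_weierstrassPExcept 0).differentiableAt hn).add (h1.differentiableAt hn)

/-- The `1/a²` in `℘(a)` combines with the `σ` quotient to the defect divided by `a²`; both values
subtracted by the two slopes are zero, so the iterated slope is exactly this quotient. -/
lemma sigmaQuot_eq {a b : ℂ} (ha : a ∉ L.lattice) (hb : b ∉ L.lattice) :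
    L.sigmaQuot b a = L.sigmaQuotReg b a := by
  have ha0 : a ≠ 0 := by rintro rfl; exact ha (zero_mem _)
  have hs : L.sigma b ≠ 0 := fun h => hb (L.sigma_eq_zero_iff.mp h)
  have hP : L.sigmaProd a ≠ 0 := L.sigmaProd_ne_zero (by rintro l hl - rfl; exact ha hl)
  have h1 := L.weierstrassPExcept_def 0 a
  simp only [ZeroMemClass.coe_zero] at h1
  rw [sigmaQuot, sigmaQuotReg, dslope_of_ne _ ha0, slope_def_field, dslope_same,
    L.deriv_sigmaDefect_zero hb, dslope_of_ne _ ha0, slope_def_field, L.sigmaDefect_zero hb, h1,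
    sigmaDefect, sigma.eq_def L a]
  simp only [sub_zero]
  field_simp
  ring

lemma sigmaQuot_add_coe (b a : ℂ) (l : L.lattice) :
    L.sigmaQuot b (a + l) = L.sigmaQuot b a := by
  obtain ⟨C, η, hC, h⟩ := L.exists_sigma_add l
  have h1 : a + l + b = a + b + l := by ring
  have h2 : a + l - b = a - b + l := by ring
  rw [sigmaQuot, sigmaQuot, h1, h2, h, h, h, weierstrassP_add_coe]
  have h3 : Complex.exp (η * (a + b)) * Complex.exp (η * (a - b)) = Complex.exp (η * a) ^ 2 := by
    rw [← Complex.exp_add, ← Complex.exp_nat_mul]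
    congr 1
    push_cast
    ring
  have h4 : C * Complex.exp (η * (a + b)) * L.sigma (a + b) *
      (C * Complex.exp (η * (a - b)) * L.sigma (a - b)) =
      (C * Complex.exp (η * a)) ^ 2 * (L.sigma (a + b) * L.sigma (a - b)) := by
    linear_combination C ^ 2 * L.sigma (a + b) * L.sigma (a - b) * h3
  rw [h4, mul_pow (C * _) (L.sigma a), mul_assoc, mul_div_mul_left]
  exact pow_ne_zero 2 (mul_ne_zero hC (Complex.exp_ne_zero _))

lemma sigmaQuot_sub_coe (b a : ℂ) (l : L.lattice) :
    L.sigmaQuot b (a - l) = L.sigmaQuot b a := by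
  rw [← L.sigmaQuot_add_coe _ _ l, sub_add_cancel]

open Classical in
/-- The entire function which extends `sigmaQuot`. -/
def sigmaQuotExt (b a : ℂ) : ℂ := if a ∈ L.lattice then L.sigmaQuotReg b 0 else L.sigmaQuot b a

lemma sigmaQuotExt_sub_coe (b a : ℂ) (l : L.lattice) :
    L.sigmaQuotExt b (a - l) = L.sigmaQuotExt b a := by
  have : a - l ∈ L.lattice ↔ a ∈ L.lattice :=
    ⟨fun h => by simpa using add_mem h l.2, fun h => sub_mem h l.2⟩
  by_cases ha : a ∈ L.lattice
  · rw [sigmaQuotExt, sigmaQuotExt, if_pos ha, if_pos (this.mpr ha)]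
  · rw [sigmaQuotExt, sigmaQuotExt, if_neg ha, if_neg (this.not.mpr ha), sigmaQuot_sub_coe]

lemma differentiable_sigmaQuotExt {b : ℂ} (hb : b ∉ L.lattice) :
    Differentiable ℂ (L.sigmaQuotExt b) := by
  have h0 : DifferentiableAt ℂ (L.sigmaQuotExt b) 0 := by
    refine (L.differentiableAt_sigmaQuotReg hb).congr_of_eventuallyEq ?_
    filter_upwards [L.compl_lattice_sdiff_zero_mem_nhds] with a ha
    by_cases hal : a ∈ L.lattice
    · have : a = 0 := by by_contra h; exact ha ⟨hal, h⟩
      simp [sigmaQuotExt, this]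
    · rw [sigmaQuotExt, if_neg hal, L.sigmaQuot_eq hal hb]
  intro a
  by_cases ha : a ∈ L.lattice
  · have h1 : L.sigmaQuotExt b = fun z => L.sigmaQuotExt b (z - a) :=
      funext fun z => (L.sigmaQuotExt_sub_coe b z ⟨a, ha⟩).symm
    rw [h1]
    refine DifferentiableAt.fun_comp' a (g := L.sigmaQuotExt b) ?_ (by fun_prop)
    simpa using h0
  · have hs : L.sigma a ≠ 0 := fun h => ha (L.sigma_eq_zero_iff.mp h)
    have hs' : L.sigma b ≠ 0 := fun h => hb (L.sigma_eq_zero_iff.mp h)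
    have h1 := L.differentiable_sigma
    have h2 : DifferentiableAt ℂ (L.sigmaQuot b) a := by
      have := L.differentiableOn_weierstrassP.differentiableAt (L.isOpen_compl_lattice.mem_nhds ha)
      unfold sigmaQuot
      exact this.add (DifferentiableAt.div (by fun_prop) (by fun_prop)
        (mul_ne_zero (pow_ne_zero 2 hs) (pow_ne_zero 2 hs')))
    refine h2.congr_of_eventuallyEq ?_
    filter_upwards [L.isOpen_compl_lattice.mem_nhds ha] with z hz
    exact if_neg hz

/-- By quasi-periodicity `sigmaQuotExt` is an entire function with the lattice as periods, so it is
bounded and constant. At `a = b` the `σ` term vanishes and the constant is `℘(b)`. -/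
theorem weierstrassP_sub_mul_sigma_sq {a b : ℂ} (ha : a ∉ L.lattice) (hb : b ∉ L.lattice) :
    (L.weierstrassP a - L.weierstrassP b) * (L.sigma a ^ 2 * L.sigma b ^ 2) =
      -(L.sigma (a + b) * L.sigma (a - b)) := by
  have hd := L.differentiable_sigmaQuotExt hb
  have h := hd.apply_eq_apply_of_bounded (IsZLattice.isCompact_range_of_periodic L.lattice _
    hd.continuous fun z w hw => by
      have := L.sigmaQuotExt_sub_coe b (z + w) ⟨w, hw⟩
      simpa using this.symm).isBounded a b
  rw [sigmaQuotExt, sigmaQuotExt, if_neg ha, if_neg hb, sigmaQuot, sigmaQuot, sub_self,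
    L.sigma_eq_zero_iff.mpr (zero_mem _), mul_zero, zero_div, add_zero] at h
  have hs : L.sigma a ≠ 0 := fun h => ha (L.sigma_eq_zero_iff.mp h)
  have hs' : L.sigma b ≠ 0 := fun h => hb (L.sigma_eq_zero_iff.mp h)
  rw [← h]
  field_simp
  ring

end PeriodPair

namespace EllipticPainleve

/-! ### Homogeneous coordinates of `℘` and their determinants -/

/-- The determinant of two vectors of the plane. -/
def br (v w : Fin 2 → ℂ) : ℂ := v 0 * w 1 - v 1 * w 0

open Classical in
/-- Homogeneous coordinates of `℘(u)`, also at the poles. -/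
def wpVec (L : PeriodPair) (u : ℂ) : Fin 2 → ℂ :=
  if u ∈ L.lattice then ![1, 0] else ![L.weierstrassP u, 1]

lemma wpVec_of_mem {L : PeriodPair} {u : ℂ} (hu : u ∈ L.lattice) : wpVec L u = ![1, 0] :=
  if_pos hu

lemma wpVec_of_notMem {L : PeriodPair} {u : ℂ} (hu : u ∉ L.lattice) :
    wpVec L u = ![L.weierstrassP u, 1] :=
  if_neg hu

lemma wpVec_neg (L : PeriodPair) (u : ℂ) : wpVec L (-u) = wpVec L u := by
  by_cases hu : u ∈ L.lattice
  · rw [wpVec_of_mem hu, wpVec_of_mem (neg_mem hu)]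
  · rw [wpVec_of_notMem hu, wpVec_of_notMem (by rwa [neg_mem_iff]), L.weierstrassP_neg]

/-- The exponential factors at `b` and `-b` are inverse to each other. The constant left over
normalizes the coordinates at a lattice point, where `σ(l)²` would be zero. -/
lemma exists_sigma_add_mul_sigma_sub {L : PeriodPair} {l : ℂ} (hl : l ∈ L.lattice) :
    ∃ c : ℂ, c ≠ 0 ∧ ∀ b, L.sigma (b + l) * L.sigma (b - l) = c * L.sigma b ^ 2 := by
  obtain ⟨C, η, hC, h⟩ := L.exists_sigma_add ⟨l, hl⟩
  refine ⟨C ^ 2, pow_ne_zero 2 hC, fun b => ?_⟩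
  have h1 : b - l = -(-b + l) := by ring
  rw [h1, L.sigma_neg, h, h, L.sigma_neg, mul_neg η, Complex.exp_neg]
  have := Complex.exp_ne_zero (η * b)
  field_simp

/-- After a normalization of the vectors `wpVec`, their determinants are products of values
of `σ`. -/
theorem exists_wpVec_normalization (L : PeriodPair) :
    ∃ N : ℂ → ℂ, (∀ u, N u ≠ 0) ∧ (∀ u, u ∉ L.lattice → N u = L.sigma u ^ 2) ∧
      ∀ a b, N a * N b * br (wpVec L a) (wpVec L b) = -(L.sigma (a + b) * L.sigma (a - b)) := by
  classical
  choose! c hc using fun (l : ℂ) (hl : l ∈ L.lattice) => exists_sigma_add_mul_sigma_sub hl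
  refine ⟨fun u => if u ∈ L.lattice then c u else L.sigma u ^ 2, fun u => ?_, fun u hu => if_neg hu,
    fun a b => ?_⟩
  · dsimp only
    split_ifs with hu
    · exact (hc u hu).1
    · exact pow_ne_zero 2 fun h => hu (L.sigma_eq_zero_iff.mp h)
  · dsimp only
    by_cases ha : a ∈ L.lattice <;> by_cases hb : b ∈ L.lattice
    · rw [wpVec_of_mem ha, wpVec_of_mem hb, L.sigma_eq_zero_iff.mpr (add_mem ha hb)]
      simp [br]
    · have h1 := (hc a ha).2 b
      have h2 : a - b = -(b - a) := by ring
      rw [wpVec_of_mem ha, wpVec_of_notMem hb, if_pos ha, if_neg hb, h2, L.sigma_neg, add_comm a b]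
      simp [br, h1]
    · have h1 := (hc b hb).2 a
      rw [wpVec_of_notMem ha, wpVec_of_mem hb, if_neg ha, if_pos hb, h1]
      simp [br]
      ring
    · rw [wpVec_of_notMem ha, wpVec_of_notMem hb, if_neg ha, if_neg hb,
        ← L.weierstrassP_sub_mul_sigma_sq ha hb]
      simp [br]
      ring

/-- The zeros of `σ` are the lattice points, so the fibres of `℘` as a map to `ℙ¹` can be read off
without excluding poles. -/
lemma br_wpVec_eq_zero_iff {L : PeriodPair} {a b : ℂ} :
    br (wpVec L a) (wpVec L b) = 0 ↔ a + b ∈ L.lattice ∨ a - b ∈ L.lattice := by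
  obtain ⟨N, hN, -, h⟩ := exists_wpVec_normalization L
  rw [← L.sigma_eq_zero_iff, ← L.sigma_eq_zero_iff, ← mul_eq_zero, ← neg_eq_zero (a := _ * _), ← h]
  simp [hN]

/-! ### Möbius maps and plane linear algebra -/

open Matrix

lemma mulVec_zero_apply (W : Matrix (Fin 2) (Fin 2) ℂ) (v : Fin 2 → ℂ) :
    (W *ᵥ v) 0 = W 0 0 * v 0 + W 0 1 * v 1 := by
  simp [mulVec, dotProduct, Fin.sum_univ_two]

lemma mulVec_one_apply (W : Matrix (Fin 2) (Fin 2) ℂ) (v : Fin 2 → ℂ) :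
    (W *ᵥ v) 1 = W 1 0 * v 0 + W 1 1 * v 1 := by
  simp [mulVec, dotProduct, Fin.sum_univ_two]

lemma br_smul_left (c : ℂ) (v w : Fin 2 → ℂ) : br (c • v) w = c * br v w := by
  simp [br]; ring

lemma br_smul_right (c : ℂ) (v w : Fin 2 → ℂ) : br v (c • w) = c * br v w := by
  simp [br]; ring

lemma br_add_left (v v' w : Fin 2 → ℂ) : br (v + v') w = br v w + br v' w := by
  simp [br]; ring

lemma br_self (v : Fin 2 → ℂ) : br v v = 0 := by simp [br]; ring

lemma br_swap (v w : Fin 2 → ℂ) : br w v = -br v w := by simp [br]; ring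

lemma br_eq_zero_comm {v w : Fin 2 → ℂ} : br v w = 0 ↔ br w v = 0 := by
  rw [br_swap w v, neg_eq_zero]

lemma br_mulVec (W : Matrix (Fin 2) (Fin 2) ℂ) (v w : Fin 2 → ℂ) :
    br (W *ᵥ v) (W *ᵥ w) = W.det * br v w := by
  simp only [br, mulVec_zero_apply, mulVec_one_apply, det_fin_two]
  ring

/-- The Plücker relation. -/
lemma br_plucker (p q r s : Fin 2 → ℂ) :
    br p q * br r s - br p r * br q s + br p s * br q r = 0 := by
  simp only [br]; ring

/-- Vectors with vanishing determinant are proportional. -/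
lemma exists_smul_of_br_eq_zero {v w : Fin 2 → ℂ} (hv : v ≠ 0) (hw : w ≠ 0) (h : br v w = 0) :
    ∃ c : ℂ, c ≠ 0 ∧ v = c • w := by
  have hw' : w 0 ≠ 0 ∨ w 1 ≠ 0 := by
    by_contra! h0
    exact hw (funext fun i => by fin_cases i <;> simp [h0])
  have key : ∃ c : ℂ, v = c • w := by
    simp only [br] at h
    rcases hw' with h0 | h1
    · refine ⟨v 0 / w 0, funext fun i => ?_⟩
      fin_cases i
      · simp [h0]
      · simp
        field_simp
        linear_combination -h
    · refine ⟨v 1 / w 1, funext fun i => ?_⟩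
      fin_cases i
      · simp
        field_simp
        linear_combination h
      · simp [h1]
  obtain ⟨c, rfl⟩ := key
  refine ⟨c, ?_, rfl⟩
  rintro rfl
  simp at hv

lemma br_eq_zero_congr {v w y : Fin 2 → ℂ} (hv : v ≠ 0) (hw : w ≠ 0) (h : br v w = 0) :
    br v y = 0 ↔ br w y = 0 := by
  obtain ⟨c, hc, rfl⟩ := exists_smul_of_br_eq_zero hv hw h
  rw [br_smul_left]
  simp [hc]

lemma mulVec_ne_zero {W : Matrix (Fin 2) (Fin 2) ℂ} (hW : W.det ≠ 0) {v : Fin 2 → ℂ}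
    (hv : v ≠ 0) : W *ᵥ v ≠ 0 :=
  fun h => hv (eq_zero_of_mulVec_eq_zero hW h)

lemma hom_coe (z : ℂ) : hom (z : OnePoint ℂ) = ![z, 1] := rfl

lemma hom_infty : hom ∞ = ![1, 0] := rfl

lemma hom_ne_zero (z : OnePoint ℂ) : hom z ≠ 0 := by
  intro h
  induction z using OnePoint.rec with
  | infty => simpa [hom_infty] using congrFun h 0
  | coe z => simpa [hom_coe] using congrFun h 1

lemma br_hom_eq_zero_iff {x y : OnePoint ℂ} : br (hom x) (hom y) = 0 ↔ x = y := by
  induction x using OnePoint.rec <;> induction y using OnePoint.rec <;>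
    simp [hom_infty, hom_coe, br, sub_eq_zero]

lemma represents_iff {v : Fin 2 → ℂ} {z : OnePoint ℂ} :
    Represents v z ↔ v ≠ 0 ∧ br v (hom z) = 0 := by
  constructor
  · rintro ⟨c, hc, rfl⟩
    exact ⟨smul_ne_zero hc (hom_ne_zero z), by rw [br_smul_left, br_self, mul_zero]⟩
  · rintro ⟨hv, h⟩
    exact exists_smul_of_br_eq_zero hv (hom_ne_zero z) h

lemma mobiusMap_iff {N : Matrix (Fin 2) (Fin 2) ℂ} (hN : N.det ≠ 0) {z w : OnePoint ℂ} :
    MobiusMap N z w ↔ br (N *ᵥ hom z) (hom w) = 0 := by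
  rw [MobiusMap, represents_iff, and_iff_right (mulVec_ne_zero hN (hom_ne_zero z))]

/-- A quadratic form in two variables is zero if it vanishes at three points of the line. -/
lemma quadratic_eq_zero {a b c x₁ x₂ x₃ : ℂ} (h₁₂ : x₁ ≠ x₂) (h₁₃ : x₁ ≠ x₃) (h₂₃ : x₂ ≠ x₃)
    (h₁ : a * x₁ ^ 2 + b * x₁ + c = 0) (h₂ : a * x₂ ^ 2 + b * x₂ + c = 0)
    (h₃ : a * x₃ ^ 2 + b * x₃ + c = 0) : a = 0 ∧ b = 0 ∧ c = 0 := by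
  have k₁ : a * (x₁ + x₂) + b = 0 := by
    apply mul_left_cancel₀ (sub_ne_zero.mpr h₁₂)
    linear_combination h₁ - h₂
  have k₂ : a * (x₁ + x₃) + b = 0 := by
    apply mul_left_cancel₀ (sub_ne_zero.mpr h₁₃)
    linear_combination h₁ - h₃
  have ha : a = 0 := by
    apply mul_left_cancel₀ (sub_ne_zero.mpr h₂₃)
    linear_combination k₁ - k₂
  subst ha
  have hb : b = 0 := by linear_combination k₁
  subst hb
  exact ⟨rfl, rfl, by linear_combination h₁⟩

/-- Two Möbius maps which take the same values at three points are equal. -/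
lemma br_mulVec_eq_zero_iff_of_three_points {W G : Matrix (Fin 2) (Fin 2) ℂ} (hW : W.det ≠ 0)
    (hG : G.det ≠ 0) {p : Fin 3 → ℂ × ℂ} (hp : Function.Injective fun i => (p i).1)
    (hWp : ∀ i, br (W *ᵥ ![(p i).1, 1]) ![(p i).2, 1] = 0)
    (hGp : ∀ i, br (G *ᵥ ![(p i).1, 1]) ![(p i).2, 1] = 0) {v : Fin 2 → ℂ} (hv : v ≠ 0)
    (y : Fin 2 → ℂ) : br (W *ᵥ v) y = 0 ↔ br (G *ᵥ v) y = 0 := by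
  refine br_eq_zero_congr (mulVec_ne_zero hW hv) (mulVec_ne_zero hG hv) ?_
  have hne : ∀ z : ℂ, (![z, 1] : Fin 2 → ℂ) ≠ 0 := fun z => hom_ne_zero z
  have h : ∀ i, br (W *ᵥ ![(p i).1, 1]) (G *ᵥ ![(p i).1, 1]) = 0 := fun i => by
    rw [br_eq_zero_congr (mulVec_ne_zero hW (hne _)) (hne _) (hWp i), br_eq_zero_comm]
    exact hGp i
  -- The determinant of `W v` and `G v` is a quadratic form in `v`, here written in the affine
  -- coordinate.
  have h' : ∀ i, (W 0 0 * G 1 0 - W 1 0 * G 0 0) * (p i).1 ^ 2 +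
      (W 0 0 * G 1 1 + W 0 1 * G 1 0 - W 1 0 * G 0 1 - W 1 1 * G 0 0) * (p i).1 +
      (W 0 1 * G 1 1 - W 1 1 * G 0 1) = 0 := fun i => by
    rw [← h i]
    simp only [br, mulVec_zero_apply, mulVec_one_apply]
    simp
    ring
  have hpp : ∀ i j, i ≠ j → (p i).1 ≠ (p j).1 := fun i j hij => hp.ne hij
  obtain ⟨h₁, h₂, h₃⟩ := quadratic_eq_zero (hpp 0 1 (by decide)) (hpp 0 2 (by decide))
    (hpp 1 2 (by decide)) (h' 0) (h' 1) (h' 2)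
  simp only [br, mulVec_zero_apply, mulVec_one_apply]
  linear_combination v 0 ^ 2 * h₁ + v 0 * v 1 * h₂ + v 1 ^ 2 * h₃

/-! ### The determinant through three points as a Möbius relation -/

section form

variable (p : Fin 3 → ℂ × ℂ)

/-- Expansion along the first row gives a bilinear form in the coordinates of `x` and `y`, whose
coefficients are the minors. -/
lemma form_eq_br_solveX (x y : OnePoint ℂ) :
    form p x y = -br (solveX p *ᵥ hom y) (hom x) := by
  simp only [form, br, mulVec_zero_apply, mulVec_one_apply, solveX, minor, det_succ_row_zero]
  simp [Fin.sum_univ_succ, Fin.succAbove, submatrix]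
  ring

lemma form_eq_br_solveY (x y : OnePoint ℂ) :
    form p x y = br (solveY p *ᵥ hom x) (hom y) := by
  simp only [form, br, mulVec_zero_apply, mulVec_one_apply, solveY, minor, det_succ_row_zero]
  simp [Fin.sum_univ_succ, Fin.succAbove, submatrix]
  ring

/-- Transposes two columns. This reduces the equation for `f` to that for `g`. -/
lemma form_swap (x y : OnePoint ℂ) : form (fun i => (p i).swap) y x = -form p x y := by
  simp only [form, det_succ_row_zero]
  simp [Fin.sum_univ_succ, Fin.succAbove, submatrix]
  ring

/-- The determinant is the product of the Vandermonde determinants of the two coordinates, so it is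
nonzero when each coordinate separates the points. -/
lemma det_solveX : (solveX p).det =
    ((p 0).1 - (p 1).1) * ((p 0).1 - (p 2).1) * ((p 1).1 - (p 2).1) *
      (((p 0).2 - (p 1).2) * ((p 0).2 - (p 2).2) * ((p 1).2 - (p 2).2)) := by
  simp only [solveX, minor, det_fin_two, det_fin_three]
  simp
  ring

lemma det_solveY : (solveY p).det =
    ((p 0).1 - (p 1).1) * ((p 0).1 - (p 2).1) * ((p 1).1 - (p 2).1) *
      (((p 0).2 - (p 1).2) * ((p 0).2 - (p 2).2) * ((p 1).2 - (p 2).2)) := by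
  simp only [solveY, minor, det_fin_two, det_fin_three]
  simp
  ring

lemma form_self (i : Fin 3) : form p (p i).1 (p i).2 = 0 := by
  simp only [form, det_succ_row_zero, hom_coe]
  fin_cases i <;> simp [Fin.sum_univ_succ, Fin.succAbove, submatrix] <;> ring

variable {p}

lemma det_solveX_ne_zero (h₁ : Function.Injective fun i => (p i).1)
    (h₂ : Function.Injective fun i => (p i).2) : (solveX p).det ≠ 0 := by
  have k₁ : ∀ i j, i ≠ j → (p i).1 - (p j).1 ≠ 0 := fun i j hij => sub_ne_zero.mpr (h₁.ne hij)
  have k₂ : ∀ i j, i ≠ j → (p i).2 - (p j).2 ≠ 0 := fun i j hij => sub_ne_zero.mpr (h₂.ne hij)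
  rw [det_solveX]
  simp only [ne_eq, mul_eq_zero, not_or]
  exact ⟨⟨⟨k₁ _ _ (by decide), k₁ _ _ (by decide)⟩, k₁ _ _ (by decide)⟩,
    ⟨⟨k₂ _ _ (by decide), k₂ _ _ (by decide)⟩, k₂ _ _ (by decide)⟩⟩

lemma det_solveY_ne_zero (h₁ : Function.Injective fun i => (p i).1)
    (h₂ : Function.Injective fun i => (p i).2) : (solveY p).det ≠ 0 := by
  rw [det_solveY, ← det_solveX]
  exact det_solveX_ne_zero h₁ h₂

lemma form_eq_zero_iff_mobiusMap_solveX (h₁ : Function.Injective fun i => (p i).1)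
    (h₂ : Function.Injective fun i => (p i).2) (x y : OnePoint ℂ) :
    form p x y = 0 ↔ MobiusMap (solveX p) y x := by
  rw [mobiusMap_iff (det_solveX_ne_zero h₁ h₂), form_eq_br_solveX, neg_eq_zero]

lemma form_eq_zero_iff_mobiusMap_solveY (h₁ : Function.Injective fun i => (p i).1)
    (h₂ : Function.Injective fun i => (p i).2) (x y : OnePoint ℂ) :
    form p x y = 0 ↔ MobiusMap (solveY p) x y := by
  rw [mobiusMap_iff (det_solveY_ne_zero h₁ h₂), form_eq_br_solveY]

/-- The form given by three points describes every Möbius map through these points. -/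
lemma form_eq_zero_iff_br (h₁ : Function.Injective fun i => (p i).1)
    (h₂ : Function.Injective fun i => (p i).2) {W : Matrix (Fin 2) (Fin 2) ℂ} (hW : W.det ≠ 0)
    (hWp : ∀ i, br (W *ᵥ ![(p i).1, 1]) ![(p i).2, 1] = 0) (x y : OnePoint ℂ) :
    form p x y = 0 ↔ br (W *ᵥ hom x) (hom y) = 0 := by
  rw [form_eq_br_solveY]
  refine (br_mulVec_eq_zero_iff_of_three_points hW (det_solveY_ne_zero h₁ h₂) h₁ hWp (fun i => ?_)
    (hom_ne_zero x) _).symm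
  have := form_self p i
  rwa [form_eq_br_solveY] at this

end form

/-! ### Normalized coordinates and the relations of `σ` -/

/-- The normalizing factors of the vectors `wpVec`. -/
def sigmaNorm (L : PeriodPair) : ℂ → ℂ := (exists_wpVec_normalization L).choose

lemma sigmaNorm_ne_zero (L : PeriodPair) (u : ℂ) : sigmaNorm L u ≠ 0 :=
  (exists_wpVec_normalization L).choose_spec.1 u

lemma sigmaNorm_of_notMem {L : PeriodPair} {u : ℂ} (hu : u ∉ L.lattice) :
    sigmaNorm L u = L.sigma u ^ 2 :=
  (exists_wpVec_normalization L).choose_spec.2.1 u hu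

/-- The normalized homogeneous coordinates `(℘(u) σ(u)², σ(u)²)` of `℘(u)`. -/
def sigmaVec (L : PeriodPair) (u : ℂ) : Fin 2 → ℂ := sigmaNorm L u • wpVec L u

lemma br_sigmaVec (L : PeriodPair) (a b : ℂ) :
    br (sigmaVec L a) (sigmaVec L b) = -(L.sigma (a + b) * L.sigma (a - b)) := by
  rw [sigmaVec, sigmaVec, br_smul_left, br_smul_right, ← mul_assoc]
  exact (exists_wpVec_normalization L).choose_spec.2.2 a b

lemma br_sigmaVec_left_eq_zero_iff {L : PeriodPair} {u : ℂ} {v : Fin 2 → ℂ} :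
    br (sigmaVec L u) v = 0 ↔ br (wpVec L u) v = 0 := by
  simp [sigmaVec, br_smul_left, sigmaNorm_ne_zero]

lemma br_sigmaVec_right_eq_zero_iff {L : PeriodPair} {u : ℂ} {v : Fin 2 → ℂ} :
    br v (sigmaVec L u) = 0 ↔ br v (wpVec L u) = 0 := by
  simp [sigmaVec, br_smul_right, sigmaNorm_ne_zero]

lemma wpVec_ne_zero (L : PeriodPair) (u : ℂ) : wpVec L u ≠ 0 := by
  by_cases hu : u ∈ L.lattice
  · rw [wpVec_of_mem hu]; exact hom_ne_zero ∞
  · rw [wpVec_of_notMem hu]; exact hom_ne_zero (L.weierstrassP u : OnePoint ℂ)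

lemma sigmaVec_ne_zero (L : PeriodPair) (u : ℂ) : sigmaVec L u ≠ 0 :=
  smul_ne_zero (sigmaNorm_ne_zero L u) (wpVec_ne_zero L u)

lemma hom_weierstrassP {L : PeriodPair} {u : ℂ} (hu : u ∉ L.lattice) :
    hom (L.weierstrassP u : OnePoint ℂ) = wpVec L u := by
  rw [wpVec_of_notMem hu, hom_coe]

lemma weierstrassP_eq_iff {L : PeriodPair} {u v : ℂ} (hu : u ∉ L.lattice) (hv : v ∉ L.lattice) :
    L.weierstrassP u = L.weierstrassP v ↔ br (wpVec L u) (wpVec L v) = 0 := by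
  rw [wpVec_of_notMem hu, wpVec_of_notMem hv]
  simp [br, sub_eq_zero]

/-- The three-term relation of the `σ` function. -/
lemma sigma_three_term (L : PeriodPair) (p q r s : ℂ) :
    L.sigma (p + q) * L.sigma (p - q) * (L.sigma (r + s) * L.sigma (r - s)) -
      L.sigma (p + r) * L.sigma (p - r) * (L.sigma (q + s) * L.sigma (q - s)) +
      L.sigma (p + s) * L.sigma (p - s) * (L.sigma (q + r) * L.sigma (q - r)) = 0 := by
  have := br_plucker (sigmaVec L p) (sigmaVec L q) (sigmaVec L r) (sigmaVec L s)
  simp only [br_sigmaVec] at this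
  linear_combination this

lemma sigma_sub_comm (L : PeriodPair) (x y : ℂ) : L.sigma (x - y) = -L.sigma (y - x) := by
  rw [← L.sigma_neg, neg_sub]

/-- A linear substitution in the three-term relation, with half-sums chosen so that the sums and
differences are the arguments needed in `exists_onGraph_iff`. The last factor on the right is the
source of the fourth intersection point. -/
lemma sigma_four_term (L : PeriodPair) (s a b c u : ℂ) :
    L.sigma (b + c) * L.sigma (4 * s - a - c) * (L.sigma (u + a) * L.sigma (4 * s - b - u)) -
      L.sigma (a + c) * L.sigma (4 * s - b - c) * (L.sigma (u + b) * L.sigma (4 * s - a - u)) =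
    -(L.sigma (4 * s) * L.sigma (u - c) * L.sigma (b - a) *
      L.sigma (u - (4 * s - a - b - c))) := by
  have h := sigma_three_term L ((4 * s + c - u) / 2) ((c + 2 * b + u - 4 * s) / 2)
    ((4 * s + u - c) / 2) ((u + 2 * a + c - 4 * s) / 2)
  have e₁ : (4 * s + c - u) / 2 + (c + 2 * b + u - 4 * s) / 2 = b + c := by ring
  have e₂ : (4 * s + c - u) / 2 - (c + 2 * b + u - 4 * s) / 2 = 4 * s - b - u := by ring
  have e₃ : (4 * s + u - c) / 2 + (u + 2 * a + c - 4 * s) / 2 = u + a := by ring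
  have e₄ : (4 * s + u - c) / 2 - (u + 2 * a + c - 4 * s) / 2 = 4 * s - a - c := by ring
  have e₅ : (4 * s + c - u) / 2 + (4 * s + u - c) / 2 = 4 * s := by ring
  have e₆ : (4 * s + c - u) / 2 - (4 * s + u - c) / 2 = c - u := by ring
  have e₇ : (c + 2 * b + u - 4 * s) / 2 + (u + 2 * a + c - 4 * s) / 2 =
    u - (4 * s - a - b - c) := by ring
  have e₈ : (c + 2 * b + u - 4 * s) / 2 - (u + 2 * a + c - 4 * s) / 2 = b - a := by ring
  have e₉ : (4 * s + c - u) / 2 + (u + 2 * a + c - 4 * s) / 2 = a + c := by ring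
  have e₁₀ : (4 * s + c - u) / 2 - (u + 2 * a + c - 4 * s) / 2 = 4 * s - a - u := by ring
  have e₁₁ : (c + 2 * b + u - 4 * s) / 2 + (4 * s + u - c) / 2 = u + b := by ring
  have e₁₂ : (c + 2 * b + u - 4 * s) / 2 - (4 * s + u - c) / 2 = -(4 * s - b - c) := by ring
  rw [e₁, e₂, e₃, e₄, e₅, e₆, e₇, e₈, e₉, e₁₀, e₁₁, e₁₂, L.sigma_neg, sigma_sub_comm L c u] at h
  linear_combination h

/-! ### Intersections of Möbius graphs with the curve -/

/-- The point `(℘(u), ℘(2s - u))` lies on the graph of the Möbius map `W`. -/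
def OnGraph (L : PeriodPair) (W : Matrix (Fin 2) (Fin 2) ℂ) (s u : ℂ) : Prop :=
  br (W *ᵥ wpVec L u) (wpVec L (2 * s - u)) = 0

lemma onGraph_iff_sigmaVec {L : PeriodPair} {W : Matrix (Fin 2) (Fin 2) ℂ} {s u : ℂ} :
    OnGraph L W s u ↔ br (W *ᵥ sigmaVec L u) (sigmaVec L (2 * s - u)) = 0 := by
  rw [br_sigmaVec_right_eq_zero_iff, sigmaVec, mulVec_smul, br_smul_left, OnGraph]
  simp [sigmaNorm_ne_zero]

/-- There is a Möbius graph through three points of the curve `u ↦ (℘(u), ℘(2s - u))`; the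
parameters of its four intersection points with the curve have the sum `4s`. -/
theorem exists_onGraph_iff {L : PeriodPair} {s a b c : ℂ} (hs : 4 * s ∉ L.lattice)
    (hab : br (wpVec L a) (wpVec L b) ≠ 0) (hac : br (wpVec L a) (wpVec L c) ≠ 0)
    (hbc : br (wpVec L b) (wpVec L c) ≠ 0)
    (hab' : br (wpVec L (2 * s - a)) (wpVec L (2 * s - b)) ≠ 0)
    (hac' : br (wpVec L (2 * s - a)) (wpVec L (2 * s - c)) ≠ 0)
    (hbc' : br (wpVec L (2 * s - b)) (wpVec L (2 * s - c)) ≠ 0) :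
    ∃ W : Matrix (Fin 2) (Fin 2) ℂ, W.det ≠ 0 ∧ ∀ u, OnGraph L W s u ↔
      u - a ∈ L.lattice ∨ u - b ∈ L.lattice ∨ u - c ∈ L.lattice ∨
        u - (4 * s - a - b - c) ∈ L.lattice := by
  set e := sigmaVec L with he
  have conv : ∀ {x y}, br (wpVec L x) (wpVec L y) ≠ 0 → br (e x) (e y) ≠ 0 := fun h => by
    rwa [ne_eq, he, br_sigmaVec_left_eq_zero_iff, br_sigmaVec_right_eq_zero_iff]
  have habs := conv hab
  have hacs := conv hac
  have hbcs := conv hbc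
  have habs' := conv hab'
  have hacs' := conv hac'
  have hbcs' := conv hbc'
  set α := br (e b) (e c) * br (e (2 * s - a)) (e (2 * s - c))
  set β := br (e a) (e c) * br (e (2 * s - b)) (e (2 * s - c))
  set A := e a
  set B := e b
  set A' := e (2 * s - a)
  set B' := e (2 * s - b)
  -- This matrix represents `α [x, A] [B', y] - β [x, B] [A', y]`, with brackets for `br`. Both
  -- terms vanish at the points with parameters `a` and `b`; the ratio of `α` to `β` is chosen so
  -- that they cancel at `c`.
  refine ⟨!![α * A 1 * B' 0 - β * B 1 * A' 0, -α * A 0 * B' 0 + β * B 0 * A' 0;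
    α * A 1 * B' 1 - β * B 1 * A' 1, -α * A 0 * B' 1 + β * B 0 * A' 1], ?_, fun u => ?_⟩
  · have : !![α * A 1 * B' 0 - β * B 1 * A' 0, -α * A 0 * B' 0 + β * B 0 * A' 0;
        α * A 1 * B' 1 - β * B 1 * A' 1, -α * A 0 * B' 1 + β * B 0 * A' 1].det =
        α * β * (br A B * br A' B') := by
      simp only [det_fin_two, br]
      simp
      ring
    rw [this]
    exact mul_ne_zero (mul_ne_zero (mul_ne_zero hbcs hacs') (mul_ne_zero hacs hbcs'))
      (mul_ne_zero habs habs')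
  · have h1 : ∀ y, br (!![α * A 1 * B' 0 - β * B 1 * A' 0, -α * A 0 * B' 0 + β * B 0 * A' 0;
        α * A 1 * B' 1 - β * B 1 * A' 1, -α * A 0 * B' 1 + β * B 0 * A' 1] *ᵥ e u) y =
        α * br (e u) A * br B' y - β * br (e u) B * br A' y := by
      intro y
      simp only [br, mulVec_zero_apply, mulVec_one_apply]
      simp
      ring
    -- Restricted to the curve, the form splits completely into `σ` factors. The factor `σ(4s)` is
    -- nonzero by `hs`, so the form does not vanish identically on the curve.
    have h2 : α * br (e u) A * br B' (e (2 * s - u)) - β * br (e u) B * br A' (e (2 * s - u)) =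
        L.sigma (b - c) * L.sigma (a - c) * L.sigma (u - a) * L.sigma (u - b) *
          (L.sigma (4 * s) * L.sigma (u - c) * L.sigma (b - a) *
            L.sigma (u - (4 * s - a - b - c))) := by
      simp only [α, β, A, B, A', B', he, br_sigmaVec]
      have k₁ : ∀ x y, 2 * s - x + (2 * s - y) = 4 * s - x - y := fun x y => by ring
      have k₂ : ∀ x y, 2 * s - x - (2 * s - y) = y - x := fun x y => by ring
      simp only [k₁, k₂, sigma_sub_comm L c a, sigma_sub_comm L c b]
      linear_combination (-L.sigma (b - c) * L.sigma (a - c) * L.sigma (u - a) * L.sigma (u - b)) *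
        sigma_four_term L s a b c u
    rw [onGraph_iff_sigmaVec, ← he, h1, h2]
    have nz : ∀ {x y}, br (e x) (e y) ≠ 0 → L.sigma (x - y) ≠ 0 := fun hxy h => by
      rw [he, br_sigmaVec, h] at hxy
      simp at hxy
    have hab0 := nz habs
    rw [sigma_sub_comm, neg_ne_zero] at hab0
    simp only [mul_eq_zero, nz hbcs, nz hacs, hab0, L.sigma_eq_zero_iff, hs, false_or, or_false]
    tauto

/-! ### The matrix `M` and its action on graphs -/

/-- The map `v ↦ M(h, κ₁, κ₂, s) v`, up to a constant factor, on vectors `h` and `v` of homogeneous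
coordinates. -/
def reflMap (L : PeriodPair) (κ₁ κ₂ s : ℂ) (h v : Fin 2 → ℂ) : Fin 2 → ℂ :=
  (-(br h (sigmaVec L κ₂) * br v (sigmaVec L (2 * s - κ₁)))) •
      sigmaVec L (2 * (s - (κ₁ + κ₂) / 4) + κ₁) +
    (br h (sigmaVec L κ₁) * br v (sigmaVec L (2 * s - κ₂))) •
      sigmaVec L (2 * (s - (κ₁ + κ₂) / 4) + κ₂)

/-- For fixed `h` the map is linear in `v`, and the factor of `br v w` is its determinant. Under
regularity it vanishes only when `h` represents `℘(κ₁)` or `℘(κ₂)`. -/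
lemma br_reflMap (L : PeriodPair) (κ₁ κ₂ s : ℂ) (h v w : Fin 2 → ℂ) :
    br (reflMap L κ₁ κ₂ s h v) (reflMap L κ₁ κ₂ s h w) =
      br h (sigmaVec L κ₁) * br h (sigmaVec L κ₂) *
        (br (sigmaVec L (2 * s - κ₂)) (sigmaVec L (2 * s - κ₁)) *
          br (sigmaVec L (2 * (s - (κ₁ + κ₂) / 4) + κ₁))
            (sigmaVec L (2 * (s - (κ₁ + κ₂) / 4) + κ₂))) * br v w := by
  simp only [reflMap, br, Pi.add_apply, Pi.smul_apply, smul_eq_mul]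
  ring

/-- `M(℘(u), κ₁, κ₂, s)` maps `℘(2s - u)` to `℘(2s' - u)`, `s' = s - (κ₁ + κ₂) / 4`. -/
lemma br_reflMap_sigmaVec (L : PeriodPair) (κ₁ κ₂ s u : ℂ) :
    br (reflMap L κ₁ κ₂ s (sigmaVec L u) (sigmaVec L (2 * s - u)))
      (sigmaVec L (2 * (s - (κ₁ + κ₂) / 4) - u)) = 0 := by
  simp only [reflMap, br_add_left, br_smul_left, br_sigmaVec]
  have e₁ : 2 * (s - (κ₁ + κ₂) / 4) + κ₁ + (2 * (s - (κ₁ + κ₂) / 4) - u) = 4 * s - u - κ₂ := by ring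
  have e₂ : 2 * (s - (κ₁ + κ₂) / 4) + κ₂ + (2 * (s - (κ₁ + κ₂) / 4) - u) = 4 * s - u - κ₁ := by ring
  have e₃ : ∀ x, 2 * (s - (κ₁ + κ₂) / 4) + x - (2 * (s - (κ₁ + κ₂) / 4) - u) = u + x :=
    fun x => by ring
  have e₄ : ∀ x, 2 * s - u + (2 * s - x) = 4 * s - u - x := fun x => by ring
  have e₅ : ∀ x, 2 * s - u - (2 * s - x) = -(u - x) := fun x => by ring
  -- The two summands are the same product of six values of `σ` with opposite signs.
  simp only [e₁, e₂, e₃, e₄, e₅, L.sigma_neg]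
  ring

variable {L : PeriodPair} {κ₁ κ₂ s : ℂ}

lemma det_M (L : PeriodPair) (κ₁ κ₂ s : ℂ) (h : OnePoint ℂ) : (M L h κ₁ κ₂ s).det =
    (L.weierstrassP (2 * s - (κ₁ - κ₂) / 2) - L.weierstrassP (2 * s - (-κ₁ + κ₂) / 2)) *
      ((hom h 0 - L.weierstrassP κ₂ * hom h 1) *
        (L.weierstrassP (2 * s) - L.weierstrassP (2 * s - κ₂)) *
        (L.weierstrassP (2 * s - (κ₁ + κ₂) / 2) - L.weierstrassP (2 * s - (κ₁ - κ₂) / 2)) *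
      ((hom h 0 - L.weierstrassP κ₁ * hom h 1) *
        (L.weierstrassP (2 * s) - L.weierstrassP (2 * s - κ₁)) *
        (L.weierstrassP (2 * s - (κ₁ + κ₂) / 2) - L.weierstrassP (2 * s - (-κ₁ + κ₂) / 2)))) *
      (L.weierstrassP (2 * s - κ₁) - L.weierstrassP (2 * s - κ₂)) := by
  simp only [M, det_mul, det_fin_two_of]
  ring

namespace MRegular

/-- Only two factors of the determinant depend on `h`, so invertibility at one `h` passes to all
others outside their zeros. -/
lemma det_ne_zero (hM : MRegular L κ₁ κ₂ s) {h : OnePoint ℂ}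
    (h₁ : br (hom h) (wpVec L κ₁) ≠ 0) (h₂ : br (hom h) (wpVec L κ₂) ≠ 0) :
    (M L h κ₁ κ₂ s).det ≠ 0 := by
  obtain ⟨h₀, hdet⟩ := hM.det
  rw [det_M] at hdet ⊢
  rw [wpVec_of_notMem hM.k₁] at h₁
  rw [wpVec_of_notMem hM.k₂] at h₂
  have h₁' : hom h 0 - L.weierstrassP κ₁ * hom h 1 ≠ 0 := by simpa [br, mul_comm] using h₁
  have h₂' : hom h 0 - L.weierstrassP κ₂ * hom h 1 ≠ 0 := by simpa [br, mul_comm] using h₂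
  simp only [mul_ne_zero_iff] at hdet ⊢
  tauto

lemma br_wpVec_sub_ne_zero (hM : MRegular L κ₁ κ₂ s) :
    br (wpVec L (2 * s - κ₂)) (wpVec L (2 * s - κ₁)) ≠ 0 := by
  obtain ⟨h₀, hdet⟩ := hM.det
  rw [det_M] at hdet
  rw [wpVec_of_notMem hM.s₁, wpVec_of_notMem hM.s₂]
  intro h
  apply right_ne_zero_of_mul hdet
  simp [br] at h
  linear_combination -h

lemma br_wpVec_add_ne_zero (hM : MRegular L κ₁ κ₂ s) :
    br (wpVec L (2 * (s - (κ₁ + κ₂) / 4) + κ₁)) (wpVec L (2 * (s - (κ₁ + κ₂) / 4) + κ₂)) ≠ 0 := by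
  obtain ⟨h₀, hdet⟩ := hM.det
  rw [det_M] at hdet
  have e₁ : 2 * (s - (κ₁ + κ₂) / 4) + κ₁ = 2 * s - (-κ₁ + κ₂) / 2 := by ring
  have e₂ : 2 * (s - (κ₁ + κ₂) / 4) + κ₂ = 2 * s - (κ₁ - κ₂) / 2 := by ring
  rw [e₁, e₂, wpVec_of_notMem hM.s₅, wpVec_of_notMem hM.s₄]
  intro h
  apply left_ne_zero_of_mul (left_ne_zero_of_mul hdet)
  simp [br] at h
  linear_combination -h

/-- The arguments of the two `℘` in the left factor of `M` have sum `4s`; were it a period, the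
columns of that factor would be dependent. -/
lemma four_mul_notMem (hM : MRegular L κ₁ κ₂ s) : 4 * s ∉ L.lattice := by
  have := hM.br_wpVec_add_ne_zero
  rw [ne_eq, br_wpVec_eq_zero_iff, not_or] at this
  convert! this.1 using 1
  ring_nf

/-- The matrix `M` acts, up to a constant, as `reflMap`. -/
lemma exists_mulVec_eq (hM : MRegular L κ₁ κ₂ s) :
    ∃ c : ℂ, c ≠ 0 ∧ ∀ (h : OnePoint ℂ) (v : Fin 2 → ℂ),
      M L h κ₁ κ₂ s *ᵥ v = c • reflMap L κ₁ κ₂ s (hom h) v := by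
  have e₀ : 2 * s - (κ₁ + κ₂) / 2 = 2 * (s - (κ₁ + κ₂) / 4) := by ring
  have e₁ : 2 * s - (-κ₁ + κ₂) / 2 = 2 * (s - (κ₁ + κ₂) / 4) + κ₁ := by ring
  have e₂ : 2 * s - (κ₁ - κ₂) / 2 = 2 * (s - (κ₁ + κ₂) / 4) + κ₂ := by ring
  have hs₃ := hM.s₃
  have hs₄ := hM.s₄
  have hs₅ := hM.s₅
  rw [e₀] at hs₃
  rw [e₁] at hs₅
  rw [e₂] at hs₄
  have nz : ∀ {x}, x ∉ L.lattice → L.sigma x ≠ 0 := fun hx h => hx (L.sigma_eq_zero_iff.mp h)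
  have n₁ := nz hM.k₁
  have n₂ := nz hM.k₂
  have n₃ := nz hM.s₀
  have n₄ := nz hM.s₁
  have n₅ := nz hM.s₂
  have n₆ := nz hs₃
  have n₇ := nz hs₄
  have n₈ := nz hs₅
  have p₁ := L.weierstrassP_sub_mul_sigma_sq hM.s₀ hM.s₁
  have p₂ := L.weierstrassP_sub_mul_sigma_sq hM.s₀ hM.s₂
  have p₃ := L.weierstrassP_sub_mul_sigma_sq hs₃ hs₅
  have p₄ := L.weierstrassP_sub_mul_sigma_sq hs₃ hs₄
  have a₁ : 2 * s + (2 * s - κ₁) = 4 * s - κ₁ := by ring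
  have a₂ : 2 * s + (2 * s - κ₂) = 4 * s - κ₂ := by ring
  have a₃ : 2 * s - (2 * s - κ₁) = κ₁ := by ring
  have a₄ : 2 * s - (2 * s - κ₂) = κ₂ := by ring
  have a₅ : 2 * (s - (κ₁ + κ₂) / 4) + (2 * (s - (κ₁ + κ₂) / 4) + κ₁) = 4 * s - κ₂ := by ring
  have a₆ : 2 * (s - (κ₁ + κ₂) / 4) + (2 * (s - (κ₁ + κ₂) / 4) + κ₂) = 4 * s - κ₁ := by ring
  have a₇ : 2 * (s - (κ₁ + κ₂) / 4) - (2 * (s - (κ₁ + κ₂) / 4) + κ₁) = -κ₁ := by ring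
  have a₈ : 2 * (s - (κ₁ + κ₂) / 4) - (2 * (s - (κ₁ + κ₂) / 4) + κ₂) = -κ₂ := by ring
  rw [a₁, a₃, ← eq_div_iff (by simp [*])] at p₁
  rw [a₂, a₄, ← eq_div_iff (by simp [*])] at p₂
  rw [a₅, a₇, L.sigma_neg, ← eq_div_iff (by simp [*])] at p₃
  rw [a₆, a₈, L.sigma_neg, ← eq_div_iff (by simp [*])] at p₄
  -- In `σ` form both diagonal entries of `M` contain `σ(4s - κ₁) σ(4s - κ₂)`. The other factors are
  -- absorbed by the normalizations of the vectors in `reflMap`, up to this common constant.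
  set c : ℂ := -(L.sigma (4 * s - κ₁) * L.sigma (4 * s - κ₂)) /
    (L.sigma (2 * s) * L.sigma (2 * s - κ₁) * L.sigma (2 * s - κ₂) *
      L.sigma (2 * (s - (κ₁ + κ₂) / 4)) * L.sigma (2 * (s - (κ₁ + κ₂) / 4) + κ₁) *
      L.sigma (2 * (s - (κ₁ + κ₂) / 4) + κ₂)) ^ 2 with hc
  have key : ∀ (h : OnePoint ℂ) (v : Fin 2 → ℂ),
      M L h κ₁ κ₂ s *ᵥ v = c • reflMap L κ₁ κ₂ s (hom h) v := by
    intro h v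
    have expand : ∀ i, (M L h κ₁ κ₂ s *ᵥ v) i =
        -((hom h 0 - L.weierstrassP κ₂ * hom h 1) *
          ((-(L.sigma (4 * s - κ₂) * L.sigma κ₂) /
            (L.sigma (2 * s) ^ 2 * L.sigma (2 * s - κ₂) ^ 2)) *
          (-(L.sigma (4 * s - κ₁) * -L.sigma κ₂) / (L.sigma (2 * (s - (κ₁ + κ₂) / 4)) ^ 2 *
            L.sigma (2 * (s - (κ₁ + κ₂) / 4) + κ₂) ^ 2)))) *
          (v 0 - L.weierstrassP (2 * s - κ₁) * v 1) *
          (wpVec L (2 * (s - (κ₁ + κ₂) / 4) + κ₁) i) +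
        ((hom h 0 - L.weierstrassP κ₁ * hom h 1) *
          ((-(L.sigma (4 * s - κ₁) * L.sigma κ₁) /
            (L.sigma (2 * s) ^ 2 * L.sigma (2 * s - κ₁) ^ 2)) *
          (-(L.sigma (4 * s - κ₂) * -L.sigma κ₁) / (L.sigma (2 * (s - (κ₁ + κ₂) / 4)) ^ 2 *
            L.sigma (2 * (s - (κ₁ + κ₂) / 4) + κ₁) ^ 2)))) *
          (v 0 - L.weierstrassP (2 * s - κ₂) * v 1) *
          (wpVec L (2 * (s - (κ₁ + κ₂) / 4) + κ₂) i) := by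
      rw [M, e₀, e₁, e₂, p₁, p₂, p₃, p₄, wpVec_of_notMem hs₄, wpVec_of_notMem hs₅, ← mulVec_mulVec,
        ← mulVec_mulVec]
      rw [Fin.forall_fin_two]
      constructor
      · simp only [mulVec_zero_apply, mulVec_one_apply]
        simp
        ring
      · simp only [mulVec_zero_apply, mulVec_one_apply]
        simp
        ring
    have b₁ : br (hom h) (sigmaVec L κ₁) =
        L.sigma κ₁ ^ 2 * (hom h 0 - L.weierstrassP κ₁ * hom h 1) := by
      rw [sigmaVec, br_smul_right, sigmaNorm_of_notMem hM.k₁, wpVec_of_notMem hM.k₁]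
      simp only [br, cons_val_zero, cons_val_one]
      ring
    have b₂ : br (hom h) (sigmaVec L κ₂) =
        L.sigma κ₂ ^ 2 * (hom h 0 - L.weierstrassP κ₂ * hom h 1) := by
      rw [sigmaVec, br_smul_right, sigmaNorm_of_notMem hM.k₂, wpVec_of_notMem hM.k₂]
      simp only [br, cons_val_zero, cons_val_one]
      ring
    have b₃ : br v (sigmaVec L (2 * s - κ₁)) =
        L.sigma (2 * s - κ₁) ^ 2 * (v 0 - L.weierstrassP (2 * s - κ₁) * v 1) := by
      rw [sigmaVec, br_smul_right, sigmaNorm_of_notMem hM.s₁, wpVec_of_notMem hM.s₁]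
      simp only [br, cons_val_zero, cons_val_one]
      ring
    have b₄ : br v (sigmaVec L (2 * s - κ₂)) =
        L.sigma (2 * s - κ₂) ^ 2 * (v 0 - L.weierstrassP (2 * s - κ₂) * v 1) := by
      rw [sigmaVec, br_smul_right, sigmaNorm_of_notMem hM.s₂, wpVec_of_notMem hM.s₂]
      simp only [br, cons_val_zero, cons_val_one]
      ring
    ext i
    rw [expand, reflMap, b₁, b₂, b₃, b₄, sigmaVec, sigmaVec, sigmaNorm_of_notMem hs₄,
      sigmaNorm_of_notMem hs₅, hc]
    simp only [Pi.add_apply, Pi.smul_apply, smul_eq_mul]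
    clear_value c
    generalize L.sigma (2 * (s - (κ₁ + κ₂) / 4) + κ₁) = z₁ at *
    generalize L.sigma (2 * (s - (κ₁ + κ₂) / 4) + κ₂) = z₂ at *
    generalize L.sigma (2 * (s - (κ₁ + κ₂) / 4)) = z₃ at *
    generalize L.sigma (2 * s - κ₁) = z₄ at *
    generalize L.sigma (2 * s - κ₂) = z₅ at *
    generalize L.sigma (2 * s) = z₆ at *
    generalize L.weierstrassP (2 * s - κ₁) = y₁ at *
    generalize L.weierstrassP (2 * s - κ₂) = y₂ at *
    generalize wpVec L (2 * (s - (κ₁ + κ₂) / 4) + κ₁) i = w₁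
    generalize wpVec L (2 * (s - (κ₁ + κ₂) / 4) + κ₂) i = w₂
    field_simp
    ring
  -- If `c` were zero, `M` would vanish for every `h`, against the determinant condition.
  refine ⟨c, fun h0 => ?_, key⟩
  obtain ⟨h₀, hdet⟩ := hM.det
  obtain ⟨v, hv, hv0⟩ : ∃ v : Fin 2 → ℂ, v ≠ 0 ∧ M L h₀ κ₁ κ₂ s *ᵥ v = 0 :=
    ⟨hom h₀, hom_ne_zero _, by rw [key, h0, zero_smul]⟩
  exact mulVec_ne_zero hdet hv hv0

end MRegular

/-- The action of `M(·, κ₁, κ₂, s)` on a Möbius graph which contains, of the two points of the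
curve `u ↦ (℘(u), ℘(2s - u))` with parameters `κ₁` and `κ₂`, only the first one. -/
theorem exists_reflected_graph (hM : MRegular L κ₁ κ₂ s) {W : Matrix (Fin 2) (Fin 2) ℂ}
    (hW : W.det ≠ 0) (h₁ : OnGraph L W s κ₁) (h₂ : ¬ OnGraph L W s κ₂) :
    ∃ W' : Matrix (Fin 2) (Fin 2) ℂ, W'.det ≠ 0 ∧
      (∃ c : ℂ, c ≠ 0 ∧ ∀ h : OnePoint ℂ, M L h κ₁ κ₂ s *ᵥ (W *ᵥ hom h) =
        (c * br (hom h) (wpVec L κ₁)) • (W' *ᵥ hom h)) ∧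
      OnGraph L W' (s - (κ₁ + κ₂) / 4) (-κ₂) ∧
      ∀ u, br (wpVec L u) (wpVec L κ₁) ≠ 0 → br (wpVec L u) (wpVec L κ₂) ≠ 0 →
        (OnGraph L W s u ↔ OnGraph L W' (s - (κ₁ + κ₂) / 4) u) := by
  set e := sigmaVec L with he
  set X₂ := e κ₂ with hX₂
  set Y₁ := e (2 * s - κ₁) with hY₁
  set Y₂ := e (2 * s - κ₂) with hY₂
  set P := e (2 * (s - (κ₁ + κ₂) / 4) + κ₁) with hP
  set Q := e (2 * (s - (κ₁ + κ₂) / 4) + κ₂) with hQ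
  rw [onGraph_iff_sigmaVec] at h₁ h₂
  -- A linear form in `h` which vanishes at `e κ₁` is a multiple of `br h (e κ₁)`. This is the
  -- divisibility that lowers the degree from two to one.
  obtain ⟨d, hd⟩ : ∃ d : ℂ, ∀ h, br (W *ᵥ h) Y₁ = d * br h (e κ₁) := by
    have hne := sigmaVec_ne_zero L κ₁
    simp only [br, mulVec_zero_apply, mulVec_one_apply, ← he] at h₁ ⊢
    have hne' : e κ₁ 0 ≠ 0 ∨ e κ₁ 1 ≠ 0 := by
      by_contra! h0
      exact hne (funext fun i => by fin_cases i <;> simp [← he, h0])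
    rcases hne' with h0 | h0
    · refine ⟨-(W 0 1 * Y₁ 1 - W 1 1 * Y₁ 0) / e κ₁ 0, fun h => ?_⟩
      field_simp
      linear_combination h 0 * h₁
    · refine ⟨(W 0 0 * Y₁ 1 - W 1 0 * Y₁ 0) / e κ₁ 1, fun h => ?_⟩
      field_simp
      linear_combination h 1 * h₁
  have hd0 : d ≠ 0 := by
    rintro rfl
    simp only [zero_mul] at hd
    have k₁ := hd ![1, 0]
    have k₂ := hd ![0, 1]
    simp only [br, mulVec_zero_apply, mulVec_one_apply] at k₁ k₂
    simp at k₁ k₂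
    have k₃ : W.det * Y₁ 1 = 0 := by rw [det_fin_two]; linear_combination W 1 1 * k₁ - W 1 0 * k₂
    have k₄ : W.det * Y₁ 0 = 0 := by rw [det_fin_two]; linear_combination W 0 1 * k₁ - W 0 0 * k₂
    refine sigmaVec_ne_zero L (2 * s - κ₁) (funext fun i => ?_)
    fin_cases i
    · exact (mul_eq_zero.mp k₄).resolve_left hW
    · exact (mul_eq_zero.mp k₃).resolve_left hW
  have hPQ : br P Q ≠ 0 := by
    rw [hP, hQ, he, ne_eq, br_sigmaVec_left_eq_zero_iff, br_sigmaVec_right_eq_zero_iff]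
    exact hM.br_wpVec_add_ne_zero
  have hYY : br Y₂ Y₁ ≠ 0 := by
    rw [hY₁, hY₂, he, ne_eq, br_sigmaVec_left_eq_zero_iff, br_sigmaVec_right_eq_zero_iff]
    exact hM.br_wpVec_sub_ne_zero
  set W' : Matrix (Fin 2) (Fin 2) ℂ :=
    !![-d * X₂ 1 * P 0 + (W 0 0 * Y₂ 1 - W 1 0 * Y₂ 0) * Q 0,
      d * X₂ 0 * P 0 + (W 0 1 * Y₂ 1 - W 1 1 * Y₂ 0) * Q 0;
      -d * X₂ 1 * P 1 + (W 0 0 * Y₂ 1 - W 1 0 * Y₂ 0) * Q 1,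
      d * X₂ 0 * P 1 + (W 0 1 * Y₂ 1 - W 1 1 * Y₂ 0) * Q 1] with hW'
  have hW'h : ∀ h, W' *ᵥ h = (-(d * br h X₂)) • P + br (W *ᵥ h) Y₂ • Q := by
    intro h
    ext i
    revert i
    rw [Fin.forall_fin_two]
    constructor
    · simp only [mulVec_zero_apply, mulVec_one_apply, br, hW', Pi.add_apply, Pi.smul_apply]
      simp
      ring
    · simp only [mulVec_zero_apply, mulVec_one_apply, br, hW', Pi.add_apply, Pi.smul_apply]
      simp
      ring
  have hrefl : ∀ h, reflMap L κ₁ κ₂ s h (W *ᵥ h) = br h (e κ₁) • (W' *ᵥ h) := by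
    intro h
    rw [hW'h, reflMap, ← he, ← hY₁, hd, smul_add, smul_smul, smul_smul, ← hX₂, ← hP, ← hQ, ← hY₂]
    congr 2
    ring
  have hdet : W'.det ≠ 0 := by
    have : W'.det = -d * br (W *ᵥ X₂) Y₂ * br P Q := by
      simp only [hW', det_fin_two_of, br, mulVec_zero_apply, mulVec_one_apply]
      ring
    rw [this]
    exact mul_ne_zero (mul_ne_zero (neg_ne_zero.mpr hd0) h₂) hPQ
  refine ⟨W', hdet, ?_, ?_, fun u hu₁ hu₂ => ?_⟩
  · obtain ⟨c, hc, hMc⟩ := hM.exists_mulVec_eq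
    refine ⟨c * sigmaNorm L κ₁, mul_ne_zero hc (sigmaNorm_ne_zero L κ₁), fun h => ?_⟩
    rw [hMc, hrefl, smul_smul, he, sigmaVec, br_smul_right, mul_assoc]
  · rw [OnGraph, wpVec_neg, sub_neg_eq_add, ← br_sigmaVec_right_eq_zero_iff, ← he, ← hQ]
    -- At `h = X₂` the `P` component of `W' h` disappears, which produces the new point `-κ₂`.
    have h3 : br (W' *ᵥ X₂) Q = 0 := by
      rw [hW'h, br_add_left, br_smul_left, br_smul_left, br_self, br_self]
      ring
    rw [hX₂, he, sigmaVec, mulVec_smul, br_smul_left] at h3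
    exact (mul_eq_zero.mp h3).resolve_left (sigmaNorm_ne_zero L κ₂)
  · rw [ne_eq, ← br_sigmaVec_left_eq_zero_iff, ← br_sigmaVec_right_eq_zero_iff] at hu₁ hu₂
    rw [onGraph_iff_sigmaVec, onGraph_iff_sigmaVec]
    have hmul := br_reflMap L κ₁ κ₂ s (e u) (W *ᵥ e u) (e (2 * s - u))
    have hδ : br (e u) (e κ₁) * br (e u) (e κ₂) * (br Y₂ Y₁ * br P Q) ≠ 0 :=
      mul_ne_zero (mul_ne_zero hu₁ hu₂) (mul_ne_zero hYY hPQ)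
    -- Away from `κ₁` and `κ₂` the map is injective and takes `℘(2s - u)` to `℘(2s' - u)`, so
    -- incidence at `u` is the same before and after.
    have hne : reflMap L κ₁ κ₂ s (e u) (e (2 * s - u)) ≠ 0 := by
      intro h0
      have hinj : ∀ w, br (e (2 * s - u)) w = 0 := fun w => by
        have := br_reflMap L κ₁ κ₂ s (e u) (e (2 * s - u)) w
        rw [h0] at this
        have h4 : br 0 (reflMap L κ₁ κ₂ s (e u) w) = 0 := by simp [br]
        rw [h4] at this
        exact (mul_eq_zero.mp this.symm).resolve_left hδ
      have k₁ := hinj ![0, 1]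
      have k₂ := hinj ![1, 0]
      simp [br] at k₁ k₂
      exact sigmaVec_ne_zero L (2 * s - u) (funext fun i => by fin_cases i <;> assumption)
    obtain ⟨ρ, hρ, hρe⟩ := exists_smul_of_br_eq_zero hne (sigmaVec_ne_zero L _)
      (br_reflMap_sigmaVec L κ₁ κ₂ s u)
    rw [hrefl, hρe, br_smul_left, br_smul_right] at hmul
    constructor
    · intro h
      rw [← he] at h ⊢
      rw [h, mul_zero] at hmul
      exact (mul_eq_zero.mp ((mul_eq_zero.mp hmul).resolve_left hu₁)).resolve_left hρ
    · intro h
      rw [← he] at h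
      rw [h, mul_zero, mul_zero] at hmul
      exact (mul_eq_zero.mp hmul.symm).resolve_left hδ

/-! ### The chain of four reflections -/

/-- The points `(℘(κᵢ), ℘(2t - κᵢ))` are finite, and no two of them have the same first or the same
second coordinate. -/
structure GeneralParams (L : PeriodPair) (κ : Fin 8 → ℂ) (t : ℂ) : Prop where
  notMem : ∀ i, κ i ∉ L.lattice
  sub_notMem : ∀ i, 2 * t - κ i ∉ L.lattice
  inj_fst : Function.Injective fun i => L.weierstrassP (κ i)
  inj_snd : Function.Injective fun i => L.weierstrassP (2 * t - κ i)

/-- Three of the points from which `chain` starts. -/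
def startPts (L : PeriodPair) (κ : Fin 8 → ℂ) (t : ℂ) : Fin 3 → ℂ × ℂ :=
  ![(L.weierstrassP (κ 0), L.weierstrassP (2 * t - κ 0)),
    (L.weierstrassP (κ 2), L.weierstrassP (2 * t - κ 2)),
    (L.weierstrassP (κ 4), L.weierstrassP (2 * t - κ 4))]

/-- Three of the points to which `chain` leads. -/
def endPts (L : PeriodPair) (κ : Fin 8 → ℂ) (t : ℂ) : Fin 3 → ℂ × ℂ :=
  ![(L.weierstrassP (κ 7), L.weierstrassP (2 * stage κ t 4 + κ 7)),
    (L.weierstrassP (κ 5), L.weierstrassP (2 * stage κ t 4 + κ 5)),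
    (L.weierstrassP (κ 3), L.weierstrassP (2 * stage κ t 4 + κ 3))]

lemma injective_of_ne {f : Fin 3 → ℂ} (h₁ : f 0 ≠ f 1) (h₂ : f 0 ≠ f 2) (h₃ : f 1 ≠ f 2) :
    Function.Injective f := by
  intro i j h
  fin_cases i <;> fin_cases j <;> simp_all

lemma exists_represents {v : Fin 2 → ℂ} (hv : v ≠ 0) : ∃ z, Represents v z := by
  by_cases h : v 1 = 0
  · exact ⟨∞, represents_iff.mpr ⟨hv, by simp [br, hom_infty, h]⟩⟩
  · refine ⟨((v 0 / v 1 : ℂ) : OnePoint ℂ), represents_iff.mpr ⟨hv, ?_⟩⟩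
    simp [br, hom_coe]
    field_simp
    ring

variable {L : PeriodPair} {κ : Fin 8 → ℂ} {t : ℂ}

namespace GeneralParams

lemma br_ne_zero (H : GeneralParams L κ t) {i j : Fin 8} (hij : i ≠ j) :
    br (wpVec L (κ i)) (wpVec L (κ j)) ≠ 0 := by
  rw [ne_eq, ← weierstrassP_eq_iff (H.notMem i) (H.notMem j)]
  exact H.inj_fst.ne hij

lemma br_sub_ne_zero (H : GeneralParams L κ t) {i j : Fin 8} (hij : i ≠ j) :
    br (wpVec L (2 * t - κ i)) (wpVec L (2 * t - κ j)) ≠ 0 := by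
  rw [ne_eq, ← weierstrassP_eq_iff (H.sub_notMem i) (H.sub_notMem j)]
  exact H.inj_snd.ne hij

lemma sub_mem_iff (H : GeneralParams L κ t) {i j : Fin 8} : κ i - κ j ∈ L.lattice ↔ i = j := by
  constructor
  · intro h
    by_contra hij
    exact H.br_ne_zero hij (br_wpVec_eq_zero_iff.mpr (Or.inr h))
  · rintro rfl
    simp

lemma startPts_injective (H : GeneralParams L κ t) :
    (Function.Injective fun i => (startPts L κ t i).1) ∧
      Function.Injective fun i => (startPts L κ t i).2 :=
  ⟨injective_of_ne (H.inj_fst.ne (by decide)) (H.inj_fst.ne (by decide))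
    (H.inj_fst.ne (by decide)), injective_of_ne (H.inj_snd.ne (by decide))
    (H.inj_snd.ne (by decide)) (H.inj_snd.ne (by decide))⟩

/-- The graph through the points with the indices `0`, `2`, `4` contains, of the eight points, these
and the one with the index `6`. -/
theorem exists_start_graph (H : GeneralParams L κ t) (ht : 4 * t ∉ L.lattice)
    (hsum : κ 0 + κ 2 + κ 4 + κ 6 = 4 * t) :
    ∃ W : Matrix (Fin 2) (Fin 2) ℂ, W.det ≠ 0 ∧
      (∀ x y, form (startPts L κ t) x y = 0 ↔ br (W *ᵥ hom x) (hom y) = 0) ∧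
      ∀ i, OnGraph L W t (κ i) ↔ (i = 0 ∨ i = 2 ∨ i = 4 ∨ i = 6) := by
  obtain ⟨W, hW, hWu⟩ := exists_onGraph_iff ht (H.br_ne_zero (i := 0) (j := 2) (by decide))
    (H.br_ne_zero (i := 0) (j := 4) (by decide)) (H.br_ne_zero (i := 2) (j := 4) (by decide))
    (H.br_sub_ne_zero (i := 0) (j := 2) (by decide))
    (H.br_sub_ne_zero (i := 0) (j := 4) (by decide))
    (H.br_sub_ne_zero (i := 2) (j := 4) (by decide))
  have h6 : 4 * t - κ 0 - κ 2 - κ 4 = κ 6 := by linear_combination -hsum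
  have hWκ : ∀ i, OnGraph L W t (κ i) ↔ (i = 0 ∨ i = 2 ∨ i = 4 ∨ i = 6) := fun i => by
    rw [hWu, h6, H.sub_mem_iff, H.sub_mem_iff, H.sub_mem_iff, H.sub_mem_iff]
  refine ⟨W, hW, ?_, hWκ⟩
  refine form_eq_zero_iff_br H.startPts_injective.1 H.startPts_injective.2 hW ?_
  have hpt : ∀ i, (i = 0 ∨ i = 2 ∨ i = 4 ∨ i = 6) →
      br (W *ᵥ ![L.weierstrassP (κ i), 1]) ![L.weierstrassP (2 * t - κ i), 1] = 0 := fun i hi => by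
    have := (hWκ i).mpr hi
    rwa [OnGraph, wpVec_of_notMem (H.notMem i), wpVec_of_notMem (H.sub_notMem i)] at this
  intro i
  fin_cases i
  · exact hpt 0 (by decide)
  · exact hpt 2 (by decide)
  · exact hpt 4 (by decide)

lemma form_startPts_iff (H : GeneralParams L κ t) (ht : 4 * t ∉ L.lattice)
    (hsum : κ 0 + κ 2 + κ 4 + κ 6 = 4 * t) (i : Fin 8) :
    form (startPts L κ t) (L.weierstrassP (κ i)) (L.weierstrassP (2 * t - κ i)) = 0 ↔
      (i = 0 ∨ i = 2 ∨ i = 4 ∨ i = 6) := by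
  obtain ⟨W, hW, hWp, hWκ⟩ := H.exists_start_graph ht hsum
  rw [hWp, hom_weierstrassP (H.notMem i), hom_weierstrassP (H.sub_notMem i), ← hWκ i, OnGraph]

/-- On a Möbius graph the first coordinate determines the second. Hence a point of the graph with
the first coordinate of one of these four points is that point. -/
lemma eq_of_form_startPts (H : GeneralParams L κ t) (ht : 4 * t ∉ L.lattice)
    (hsum : κ 0 + κ 2 + κ 4 + κ 6 = 4 * t) {i : Fin 8} (hi : i = 0 ∨ i = 2 ∨ i = 4 ∨ i = 6)
    {y : OnePoint ℂ} (hy : form (startPts L κ t) (L.weierstrassP (κ i)) y = 0) :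
    y = (L.weierstrassP (2 * t - κ i) : OnePoint ℂ) := by
  have h := (H.form_startPts_iff ht hsum i).mpr hi
  obtain ⟨W, hW, hWp, -⟩ := H.exists_start_graph ht hsum
  rw [hWp] at h hy
  rw [br_eq_zero_congr (mulVec_ne_zero hW (hom_ne_zero _)) (hom_ne_zero _) hy] at h
  exact br_hom_eq_zero_iff.mp h

end GeneralParams

lemma stage_zero (κ : Fin 8 → ℂ) (t : ℂ) : stage κ t 0 = t := by
  simp [stage]

lemma stage_one (κ : Fin 8 → ℂ) (t : ℂ) :
    stage κ t 1 = stage κ t 0 - (κ 0 + κ 1) / 4 := by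
  simp [stage, Fin.sum_univ_eight]
  ring

lemma stage_two (κ : Fin 8 → ℂ) (t : ℂ) :
    stage κ t 2 = stage κ t 1 - (κ 2 + κ 3) / 4 := by
  simp [stage, Fin.sum_univ_eight]
  ring

lemma stage_three (κ : Fin 8 → ℂ) (t : ℂ) :
    stage κ t 3 = stage κ t 2 - (κ 4 + κ 5) / 4 := by
  simp [stage, Fin.sum_univ_eight]
  ring

lemma stage_four (κ : Fin 8 → ℂ) (t : ℂ) :
    stage κ t 4 = stage κ t 3 - (κ 6 + κ 7) / 4 := by
  simp [stage, Fin.sum_univ_eight]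
  ring

lemma two_mul_stage_four (κ : Fin 8 → ℂ) (t : ℂ) :
    2 * stage κ t 4 = 2 * t - (1 / 2) * ∑ i, κ i := by
  simp [stage, Fin.sum_univ_eight]
  ring

lemma ChainRegular.four_mul_notMem (hreg : ChainRegular L κ t) : 4 * t ∉ L.lattice := by
  have := hreg.1.four_mul_notMem
  rwa [stage_zero] at this

lemma ChainRegular.det_ne_zero (hreg : ChainRegular L κ t) {h : OnePoint ℂ}
    (hh : ∀ i, br (hom h) (wpVec L (κ i)) ≠ 0) : (chain L h κ t).det ≠ 0 := by
  obtain ⟨h0, h1, h2, h3⟩ := hreg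
  rw [chain, det_mul, det_mul, det_mul]
  exact mul_ne_zero (mul_ne_zero (mul_ne_zero (h3.det_ne_zero (hh _) (hh _))
    (h2.det_ne_zero (hh _) (hh _))) (h1.det_ne_zero (hh _) (hh _))) (h0.det_ne_zero (hh _) (hh _))

/-- The action of `chain` on a Möbius graph. -/
theorem exists_chain_graph (hreg : ChainRegular L κ t)
    (hκ : ∀ i j, i ≠ j → br (wpVec L (κ i)) (wpVec L (κ j)) ≠ 0)
    {W : Matrix (Fin 2) (Fin 2) ℂ} (hW : W.det ≠ 0)
    (hWκ : ∀ i, OnGraph L W t (κ i) ↔ (i = 0 ∨ i = 2 ∨ i = 4 ∨ i = 6)) :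
    ∃ W' : Matrix (Fin 2) (Fin 2) ℂ, W'.det ≠ 0 ∧
      (∀ h : OnePoint ℂ, (∀ i, (i = 0 ∨ i = 2 ∨ i = 4 ∨ i = 6) → br (hom h) (wpVec L (κ i)) ≠ 0) →
        ∃ c : ℂ, c ≠ 0 ∧ chain L h κ t *ᵥ (W *ᵥ hom h) = c • (W' *ᵥ hom h)) ∧
      ∀ i, (i = 1 ∨ i = 3 ∨ i = 5 ∨ i = 7) → OnGraph L W' (stage κ t 4) (-κ i) := by
  obtain ⟨r₀, r₁, r₂, r₃⟩ := hreg
  -- A point `-κᵢ` gained at one step survives the later ones, because `℘` is even and the first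
  -- coordinates differ.
  have hκn : ∀ i j, i ≠ j → br (wpVec L (-κ i)) (wpVec L (κ j)) ≠ 0 := fun i j hij => by
    rw [wpVec_neg]; exact hκ i j hij
  rw [← stage_zero κ t] at hWκ
  obtain ⟨W₁, hW₁, ⟨c₀, hc₀, hM₀⟩, hn₁, hu₁⟩ := exists_reflected_graph r₀ hW
    ((hWκ 0).mpr (by decide)) ((hWκ 1).not.mpr (by decide))
  rw [← stage_one] at hn₁ hu₁
  have g₁ : ∀ i, i ≠ 0 → i ≠ 1 →
      (OnGraph L W₁ (stage κ t 1) (κ i) ↔ (i = 0 ∨ i = 2 ∨ i = 4 ∨ i = 6)) :=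
    fun i h0 h1 => (hu₁ (κ i) (hκ i 0 h0) (hκ i 1 h1)).symm.trans (hWκ i)
  obtain ⟨W₂, hW₂, ⟨c₁, hc₁, hM₁⟩, hn₂, hu₂⟩ := exists_reflected_graph r₁ hW₁
    ((g₁ 2 (by decide) (by decide)).mpr (by decide))
    ((g₁ 3 (by decide) (by decide)).not.mpr (by decide))
  rw [← stage_two] at hn₂ hu₂
  have g₂ : ∀ i, i ≠ 0 → i ≠ 1 → i ≠ 2 → i ≠ 3 →
      (OnGraph L W₂ (stage κ t 2) (κ i) ↔ (i = 0 ∨ i = 2 ∨ i = 4 ∨ i = 6)) :=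
    fun i h0 h1 h2 h3 => (hu₂ (κ i) (hκ i 2 h2) (hκ i 3 h3)).symm.trans (g₁ i h0 h1)
  obtain ⟨W₃, hW₃, ⟨c₂, hc₂, hM₂⟩, hn₃, hu₃⟩ := exists_reflected_graph r₂ hW₂
    ((g₂ 4 (by decide) (by decide) (by decide) (by decide)).mpr (by decide))
    ((g₂ 5 (by decide) (by decide) (by decide) (by decide)).not.mpr (by decide))
  rw [← stage_three] at hn₃ hu₃
  have g₃ : ∀ i, i ≠ 0 → i ≠ 1 → i ≠ 2 → i ≠ 3 → i ≠ 4 → i ≠ 5 →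
      (OnGraph L W₃ (stage κ t 3) (κ i) ↔ (i = 0 ∨ i = 2 ∨ i = 4 ∨ i = 6)) :=
    fun i h0 h1 h2 h3 h4 h5 =>
      (hu₃ (κ i) (hκ i 4 h4) (hκ i 5 h5)).symm.trans (g₂ i h0 h1 h2 h3)
  obtain ⟨W₄, hW₄, ⟨c₃, hc₃, hM₃⟩, hn₄, hu₄⟩ := exists_reflected_graph r₃ hW₃
    ((g₃ 6 (by decide) (by decide) (by decide) (by decide) (by decide) (by decide)).mpr (by decide))
    ((g₃ 7 (by decide) (by decide) (by decide) (by decide) (by decide)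
      (by decide)).not.mpr (by decide))
  rw [← stage_four] at hn₄ hu₄
  refine ⟨W₄, hW₄, fun h hh => ?_, ?_⟩
  · refine ⟨(c₀ * br (hom h) (wpVec L (κ 0))) * ((c₁ * br (hom h) (wpVec L (κ 2))) *
      ((c₂ * br (hom h) (wpVec L (κ 4))) * (c₃ * br (hom h) (wpVec L (κ 6))))), ?_, ?_⟩
    · exact mul_ne_zero (mul_ne_zero hc₀ (hh 0 (by decide)))
        (mul_ne_zero (mul_ne_zero hc₁ (hh 2 (by decide)))
          (mul_ne_zero (mul_ne_zero hc₂ (hh 4 (by decide)))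
            (mul_ne_zero hc₃ (hh 6 (by decide)))))
    · rw [chain, ← mulVec_mulVec, ← mulVec_mulVec, ← mulVec_mulVec, hM₀]
      simp only [mulVec_smul, hM₁, hM₂, hM₃, smul_smul, mul_assoc]
  · rintro i (rfl | rfl | rfl | rfl)
    · exact (hu₄ _ (hκn 1 6 (by decide)) (hκn 1 7 (by decide))).mp
        ((hu₃ _ (hκn 1 4 (by decide)) (hκn 1 5 (by decide))).mp
          ((hu₂ _ (hκn 1 2 (by decide)) (hκn 1 3 (by decide))).mp hn₁))
    · exact (hu₄ _ (hκn 3 6 (by decide)) (hκn 3 7 (by decide))).mp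
        ((hu₃ _ (hκn 3 4 (by decide)) (hκn 3 5 (by decide))).mp hn₂)
    · exact (hu₄ _ (hκn 5 6 (by decide)) (hκn 5 7 (by decide))).mp hn₃
    · exact hn₄

/-- The points to which `chain` leads are finite, and no two of them have the same second
coordinate. -/
structure GeneralEnd (L : PeriodPair) (κ : Fin 8 → ℂ) (t : ℂ) : Prop where
  notMem : ∀ i, 2 * stage κ t 4 + κ i ∉ L.lattice
  inj : Function.Injective fun i => L.weierstrassP (2 * stage κ t 4 + κ i)

/-- `chain` maps the graph through `startPts` to the graph through `endPts`. -/
theorem form_endPts_iff_mobiusMap_chain (H : GeneralParams L κ t) (E : GeneralEnd L κ t)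
    (hreg : ChainRegular L κ t) (hsum : κ 0 + κ 2 + κ 4 + κ 6 = 4 * t) {x y : OnePoint ℂ}
    (hx : ∀ i, (i = 0 ∨ i = 2 ∨ i = 4 ∨ i = 6) → x ≠ (L.weierstrassP (κ i) : OnePoint ℂ))
    (hxy : form (startPts L κ t) x y = 0) (y' : OnePoint ℂ) :
    form (endPts L κ t) x y' = 0 ↔ MobiusMap (chain L x κ t) y y' := by
  obtain ⟨W, hW, hWp, hWκ⟩ := H.exists_start_graph hreg.four_mul_notMem hsum
  obtain ⟨W', hW', hchain, hWκ'⟩ := exists_chain_graph hreg (fun _ _ => H.br_ne_zero) hW hWκ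
  have hpt : ∀ i, (i = 1 ∨ i = 3 ∨ i = 5 ∨ i = 7) → br (W' *ᵥ ![L.weierstrassP (κ i), 1])
      ![L.weierstrassP (2 * stage κ t 4 + κ i), 1] = 0 := fun i hi => by
    have := hWκ' i hi
    rwa [OnGraph, wpVec_neg, sub_neg_eq_add, wpVec_of_notMem (H.notMem i),
      wpVec_of_notMem (E.notMem i)] at this
  rw [form_eq_zero_iff_br (W := W')
    (injective_of_ne (H.inj_fst.ne (by decide)) (H.inj_fst.ne (by decide))
      (H.inj_fst.ne (by decide)))
    (injective_of_ne (E.inj.ne (by decide)) (E.inj.ne (by decide)) (E.inj.ne (by decide))) hW'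
    (fun i => by
      fin_cases i
      · exact hpt 7 (by decide)
      · exact hpt 5 (by decide)
      · exact hpt 3 (by decide))]
  rw [hWp, br_eq_zero_comm] at hxy
  obtain ⟨d, hd, hy⟩ := exists_smul_of_br_eq_zero (hom_ne_zero y)
    (mulVec_ne_zero hW (hom_ne_zero x)) hxy
  -- Only the four points of the start graph have to be avoided. At the other `κᵢ` the chain is
  -- singular, but the vector on the graph is not in its kernel.
  obtain ⟨c, hc, hcx⟩ := hchain x fun i hi h => hx i hi (by
    rwa [← hom_weierstrassP (H.notMem i), br_hom_eq_zero_iff] at h)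
  rw [MobiusMap, hy, mulVec_smul, hcx, smul_smul, represents_iff, br_smul_left]
  have hdc := mul_ne_zero hd hc
  rw [mul_eq_zero, or_iff_right hdc,
    and_iff_right (smul_ne_zero hdc (mulVec_ne_zero hW' (hom_ne_zero x)))]

/-- A point is mapped by `chain` to the graph through `endPts` only if it lies on the graph
through `startPts`. -/
theorem form_startPts_iff_form_endPts (H : GeneralParams L κ t) (E : GeneralEnd L κ t)
    (hreg : ChainRegular L κ t) (hsum : κ 0 + κ 2 + κ 4 + κ 6 = 4 * t) {x y y' : OnePoint ℂ}
    (hx : ∀ i, x ≠ (L.weierstrassP (κ i) : OnePoint ℂ)) (hy : MobiusMap (chain L x κ t) y y') :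
    form (startPts L κ t) x y = 0 ↔ form (endPts L κ t) x y' = 0 := by
  refine ⟨fun h => (form_endPts_iff_mobiusMap_chain H E hreg hsum (fun i _ => hx i) h y').mpr hy,
    fun h => ?_⟩
  obtain ⟨W, hW, hWp, -⟩ := H.exists_start_graph hreg.four_mul_notMem hsum
  -- For the converse, `y` is compared with the point `z` of the start graph above `x`: both have
  -- the image `y'`, and the chain is invertible at `x`.
  obtain ⟨z, hz⟩ := exists_represents (mulVec_ne_zero hW (hom_ne_zero x))
  have hz' : form (startPts L κ t) x z = 0 := (hWp x z).mpr (represents_iff.mp hz).2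
  have hzm := (form_endPts_iff_mobiusMap_chain H E hreg hsum (fun i _ => hx i) hz' y').mp h
  have hdet : (chain L x κ t).det ≠ 0 := hreg.det_ne_zero fun i h => hx i (by
    rwa [← hom_weierstrassP (H.notMem i), br_hom_eq_zero_iff] at h)
  rw [mobiusMap_iff hdet] at hy hzm
  have hyz : br (chain L x κ t *ᵥ hom y) (chain L x κ t *ᵥ hom z) = 0 := by
    rw [br_eq_zero_congr (mulVec_ne_zero hdet (hom_ne_zero y)) (hom_ne_zero y') hy,
      br_eq_zero_comm]
    exact hzm
  rw [br_mulVec] at hyz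
  have : y = z := br_hom_eq_zero_iff.mp ((mul_eq_zero.mp hyz).resolve_left hdet)
  rwa [this]

/-! ### Scalar difference equations -/

/-- A first order scalar linear difference equation has a nowhere vanishing solution. -/
lemma exists_scalar_solution {l : ℂ} (hl : l ≠ 0) {c : ℂ → ℂ} (hc : ∀ t, c t ≠ 0) :
    ∃ μ : ℂ → ℂ, (∀ t, μ t ≠ 0) ∧ ∀ t, μ (t + l) = c t * μ t := by
  have orbit : ∀ r : ℂ, ∃ ν : ℤ → ℂ, (∀ n, ν n ≠ 0) ∧ ∀ n : ℤ, ν (n + 1) = c (r + n * l) * ν n := by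
    intro r
    -- Normalized by `ν 0 = 1`. Since `negSucc k` is `-(k + 1)`, the backward product has `k + 1`
    -- factors, starting at `r - l`.
    refine ⟨fun n => match n with
      | .ofNat k => ∏ j ∈ Finset.range k, c (r + j * l)
      | .negSucc k => (∏ j ∈ Finset.range (k + 1), c (r - (j + 1) * l))⁻¹, ?_, ?_⟩
    · rintro (k | k)
      · exact Finset.prod_ne_zero_iff.mpr fun _ _ => hc _
      · exact inv_ne_zero (Finset.prod_ne_zero_iff.mpr fun _ _ => hc _)
    · rintro (k | k)
      · have : Int.ofNat k + 1 = Int.ofNat (k + 1) := rfl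
        rw [this]
        simp [Finset.prod_range_succ, mul_comm]
      · have h0 : r + ((Int.negSucc k : ℤ) : ℂ) * l = r - (k + 1) * l := by
          push_cast [Int.negSucc_eq]; ring
        rw [h0]
        rcases k with _ | k
        · have : Int.negSucc 0 + 1 = Int.ofNat 0 := rfl
          rw [this]
          simp [hc]
        · have : Int.negSucc (k + 1) + 1 = Int.negSucc k := rfl
          rw [this]
          simp only []
          rw [Finset.prod_range_succ (n := k + 1), mul_inv, mul_left_comm, mul_inv_cancel₀ (hc _),
            mul_one]
  choose ν hν hνs using orbit
  -- The floor of `Re (t / l)` gives the position of `t` in its orbit; subtracting it selects one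
  -- representative per orbit.
  refine ⟨fun t => ν (t - ⌊(t / l).re⌋ * l) ⌊(t / l).re⌋, fun t => hν _ _, fun t => ?_⟩
  have h1 : ⌊((t + l) / l).re⌋ = ⌊(t / l).re⌋ + 1 := by
    rw [add_div, div_self hl, Complex.add_re, Complex.one_re, Int.floor_add_one]
  have h2 : t + l - ((⌊(t / l).re⌋ + 1 : ℤ) : ℂ) * l = t - ⌊(t / l).re⌋ * l := by
    push_cast; ring
  simp only [h1, h2, hνs]
  congr 2
  ring

/-! ### Specialization to the parameters `b` and `t` -/

variable {L : PeriodPair} {b : Fin 8 → ℂ} {t : ℂ}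

lemma two_mul_sub_cpar (b : Fin 8 → ℂ) (t : ℂ) (i : Fin 8) : 2 * t - cpar b t i = t - b i := by
  rw [cpar]; ring

lemma two_mul_sub_dpar (b : Fin 8 → ℂ) (t : ℂ) (i : Fin 8) : 2 * t - dpar b t i = b i + t := by
  rw [dpar]; ring

/-- Since `∑ cᵢ = 2λ + 8t`, the four reflections advance the time by `λ`; the sign is harmless
because `℘` is even. -/
lemma two_mul_stage_four_add_cpar (b : Fin 8 → ℂ) (t : ℂ) (i : Fin 8) :
    2 * stage (cpar b t) t 4 + cpar b t i = -(t + lam b - b i) := by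
  simp only [two_mul_stage_four, cpar, lam, Fin.sum_univ_eight]
  ring

lemma two_mul_stage_four_add_dpar (b : Fin 8 → ℂ) (t : ℂ) (i : Fin 8) :
    2 * stage (dpar b t) t 4 + dpar b t i = -(b i + (t - lam b)) := by
  simp only [two_mul_stage_four, dpar, lam, Fin.sum_univ_eight]
  ring

lemma startPts_cpar : startPts L (cpar b t) t = oddPts L b t := by
  simp only [startPts, two_mul_sub_cpar, oddPts, pt]
  rfl

lemma startPts_dpar : startPts L (dpar b t) t = fun i => (oddPts L b t i).swap := by
  funext i
  simp only [startPts, two_mul_sub_dpar, oddPts, pt]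
  fin_cases i <;> rfl

lemma endPts_cpar : endPts L (cpar b t) t = evenPts L b t := by
  simp only [endPts, two_mul_stage_four_add_cpar, evenPts, pt, L.weierstrassP_neg]
  rfl

lemma endPts_dpar : endPts L (dpar b t) t = fun i => (evenPts L b (t - lam b) i).swap := by
  funext i
  simp only [endPts, two_mul_stage_four_add_dpar, evenPts, pt, L.weierstrassP_neg,
    sub_add_cancel]
  fin_cases i <;> rfl

lemma det1_iff_startPts_dpar {x y : OnePoint ℂ} :
    Det1 L b t x y ↔ form (startPts L (dpar b t) t) y x = 0 := by
  rw [startPts_dpar, form_swap, neg_eq_zero, Det1]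

lemma det2_iff_endPts_dpar {x y : OnePoint ℂ} :
    Det2 L b (t - lam b) x y ↔ form (endPts L (dpar b t) t) y x = 0 := by
  rw [endPts_dpar, form_swap, neg_eq_zero, Det2]

lemma det1_iff_startPts_cpar {x y : OnePoint ℂ} :
    Det1 L b t x y ↔ form (startPts L (cpar b t) t) x y = 0 := by
  rw [startPts_cpar, Det1]

lemma det2_iff_endPts_cpar {x y : OnePoint ℂ} :
    Det2 L b t x y ↔ form (endPts L (cpar b t) t) x y = 0 := by
  rw [endPts_cpar, Det2]

namespace GeneralPosition

lemma cpar (H : GeneralPosition L b t) : GeneralParams L (cpar b t) t where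
  notMem := H.add_notMem
  sub_notMem i := by rw [two_mul_sub_cpar]; exact H.sub_notMem i
  inj_fst := H.inj_fst
  inj_snd := by simpa only [two_mul_sub_cpar] using H.inj_snd

lemma dpar (H : GeneralPosition L b t) : GeneralParams L (dpar b t) t where
  notMem := H.sub_notMem
  sub_notMem i := by rw [two_mul_sub_dpar]; exact H.add_notMem i
  inj_fst := H.inj_snd
  inj_snd := by simpa only [two_mul_sub_dpar] using H.inj_fst

lemma cpar_end (H : GeneralPosition L b (t + lam b)) :
    GeneralEnd L (EllipticPainleve.cpar b t) t where
  notMem i := by rw [two_mul_stage_four_add_cpar, neg_mem_iff]; exact H.sub_notMem i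
  inj := by simpa only [two_mul_stage_four_add_cpar, L.weierstrassP_neg] using H.inj_snd

lemma dpar_end (H : GeneralPosition L b (t - lam b)) :
    GeneralEnd L (EllipticPainleve.dpar b t) t where
  notMem i := by rw [two_mul_stage_four_add_dpar, neg_mem_iff]; exact H.add_notMem i
  inj := by simpa only [two_mul_stage_four_add_dpar, L.weierstrassP_neg] using H.inj_fst

lemma oddPts_injective (H : GeneralPosition L b t) :
    (Function.Injective fun i => (oddPts L b t i).1) ∧
      Function.Injective fun i => (oddPts L b t i).2 := by
  rw [← startPts_cpar]
  exact H.cpar.startPts_injective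

lemma evenPts_injective (H : GeneralPosition L b t) (H' : GeneralPosition L b (t + lam b)) :
    (Function.Injective fun i => (evenPts L b t i).1) ∧
      Function.Injective fun i => (evenPts L b t i).2 :=
  ⟨injective_of_ne (H.inj_fst.ne (by decide)) (H.inj_fst.ne (by decide))
    (H.inj_fst.ne (by decide)), injective_of_ne (H'.inj_snd.ne (by decide))
    (H'.inj_snd.ne (by decide)) (H'.inj_snd.ne (by decide))⟩

end GeneralPosition

lemma cpar_sum (hb : b 0 + b 2 + b 4 + b 6 = 0) :
    cpar b t 0 + cpar b t 2 + cpar b t 4 + cpar b t 6 = 4 * t := by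
  simp only [cpar]; linear_combination hb

lemma dpar_sum (hb : b 0 + b 2 + b 4 + b 6 = 0) :
    dpar b t 0 + dpar b t 2 + dpar b t 4 + dpar b t 6 = 4 * t := by
  simp only [dpar]; linear_combination -hb

/-- Along a solution, `G F` maps coordinates of `g(t)` to a nonzero multiple of coordinates of `g(t
+ λ)`. Rescaling by a solution of the scalar equation with this multiplier makes the relation exact;
here `λ ≠ 0` enters. -/
theorem isDetSolution_iff_linear {T : Set ℂ}
    (hT : ∀ t ∈ T, t + lam b ∈ T)
    (h₁ : ∀ t ∈ T, ∀ x y, Det1 L b t x y ↔ MobiusMap (Fmat L b t) y x)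
    (h₂ : ∀ t ∈ T, ∀ x y, Det2 L b t x y ↔ MobiusMap (Gmat L b t) x y)
    (hl : lam b ≠ 0) (f g : ℂ → OnePoint ℂ) :
    IsDetSolution L b T f g ↔ ∃ v : ℂ → Fin 2 → ℂ,
      (∀ t ∈ T, v (t + lam b) = (Gmat L b t * Fmat L b t).mulVec (v t)) ∧
      ∀ t ∈ T, Represents (v t) (g t) ∧ MobiusMap (Fmat L b t) (g t) (f t) := by
  constructor
  · intro h
    have hc : ∀ t, ∃ c : ℂ, c ≠ 0 ∧ (t ∈ T →
        (Gmat L b t * Fmat L b t) *ᵥ hom (g t) = c • hom (g (t + lam b))) := by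
      intro t
      by_cases ht : t ∈ T
      · obtain ⟨c₁, hc₁, e₁⟩ := (h₁ t ht _ _).mp (h t ht).1
        obtain ⟨c₂, hc₂, e₂⟩ := (h₂ t ht _ _).mp (h t ht).2
        refine ⟨c₁ * c₂, mul_ne_zero hc₁ hc₂, fun _ => ?_⟩
        rw [← mulVec_mulVec, e₁, mulVec_smul, e₂, smul_smul]
      -- Off `T` the multiplier is set to `1`, as the scalar equation needs a nonzero one at every
      -- time.
      · exact ⟨1, one_ne_zero, fun h => absurd h ht⟩
    choose c hc0 hc using hc
    obtain ⟨μ, hμ, hμs⟩ := exists_scalar_solution hl hc0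
    refine ⟨fun t => μ t • hom (g t), fun t ht => ?_, fun t ht =>
      ⟨⟨μ t, hμ t, rfl⟩, (h₁ t ht _ _).mp (h t ht).1⟩⟩
    simp only [mulVec_smul, hc t ht, smul_smul, hμs, mul_comm]
  · rintro ⟨v, hv, hg⟩ t ht
    refine ⟨(h₁ t ht _ _).mpr (hg t ht).2, (h₂ t ht _ _).mpr ?_⟩
    obtain ⟨c₁, hc₁, e₁⟩ := (hg t ht).1
    obtain ⟨c₂, hc₂, e₂⟩ := (hg t ht).2
    obtain ⟨c₃, hc₃, e₃⟩ := (hg _ (hT t ht)).1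
    rw [hv t ht, e₁, mulVec_smul, ← mulVec_mulVec, e₂, mulVec_smul, smul_smul] at e₃
    refine ⟨(c₁ * c₂)⁻¹ * c₃, mul_ne_zero (inv_ne_zero (mul_ne_zero hc₁ hc₂)) hc₃, ?_⟩
    rw [← smul_smul, ← e₃, smul_smul, inv_mul_cancel₀ (mul_ne_zero hc₁ hc₂), one_smul]

/-- A solution of the two determinant equations at the times `t` and `t - λ` satisfies the discrete
Painlevé equation at the time `t`. -/
theorem eq1_and_eq2_of_det (H : GeneralPosition L b t) (H₁ : GeneralPosition L b (t + lam b))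
    (H₂ : GeneralPosition L b (t - lam b)) (hc : ChainRegular L (cpar b t) t)
    (hd : ChainRegular L (dpar b t) t) (hb : b 0 + b 2 + b 4 + b 6 = 0) {x y x' y' : OnePoint ℂ}
    (hxy : ¬ IsBasePoint L b t x y) (h₁ : Det1 L b t x y) (h₂ : Det2 L b t x y')
    (h₃ : Det2 L b (t - lam b) x' y) : Eq1 L b t x y y' ∧ Eq2 L b t x y x' := by
  constructor
  · rw [det1_iff_startPts_cpar] at h₁
    rw [det2_iff_endPts_cpar] at h₂
    refine (form_endPts_iff_mobiusMap_chain H.cpar H₁.cpar_end hc (cpar_sum hb) ?_ h₁ y').mp h₂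
    rintro i hi rfl
    -- The exceptional first coordinates on the graph occur only at base points, which are excluded.
    have := H.cpar.eq_of_form_startPts hc.four_mul_notMem (cpar_sum hb) hi h₁
    rw [two_mul_sub_cpar] at this
    exact hxy ⟨i, rfl, this⟩
  · rw [det1_iff_startPts_dpar] at h₁
    rw [det2_iff_endPts_dpar] at h₃
    refine (form_endPts_iff_mobiusMap_chain H.dpar H₂.dpar_end hd (dpar_sum hb) ?_ h₁ x').mp h₃
    rintro i hi rfl
    have := H.dpar.eq_of_form_startPts hd.four_mul_notMem (dpar_sum hb) hi h₁
    rw [two_mul_sub_dpar] at this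
    exact hxy ⟨i, this, rfl⟩

/-- One step of the chain. In the new parameters the first point has parameter `-c₂` and those with
`i ≥ 3` keep `cᵢ`, so the reflected graph passes through the new points `1`, `3`, `5`. -/
theorem det1_w2_iff (H : GeneralPosition L b t) (hM : MRegular L (cpar b t 0) (cpar b t 1) t)
    (H' : GeneralPosition L (w2b b t) (w2t b t)) (hb : b 0 + b 2 + b 4 + b 6 = 0)
    {x y y' : OnePoint ℂ} (hx₀ : x ≠ (L.weierstrassP (cpar b t 0) : OnePoint ℂ))
    (hx₁ : x ≠ (L.weierstrassP (cpar b t 1) : OnePoint ℂ))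
    (hy : MobiusMap (M L x (cpar b t 0) (cpar b t 1) t) y y') :
    Det1 L b t x y ↔ Det1 L (w2b b t) (w2t b t) x y' := by
  obtain ⟨W, hW, hWp, hWκ⟩ := H.cpar.exists_start_graph hM.four_mul_notMem (cpar_sum hb)
  obtain ⟨W', hW', ⟨c, hc, hMW⟩, hneg, hu⟩ := exists_reflected_graph hM hW
    ((hWκ 0).mpr (by decide)) ((hWκ 1).not.mpr (by decide))
  have hk : ∀ i : Fin 8, 2 ≤ (i : ℕ) → w2b b t i + w2t b t = cpar b t i ∧ w2t b t - w2b b t i =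
      2 * (t - (cpar b t 0 + cpar b t 1) / 4) - cpar b t i := fun i hi => by
    rw [w2b, if_neg (by omega), w2t]
    simp only [cpar]
    constructor <;> ring
  have hk₀ : w2b b t 0 + w2t b t = -cpar b t 1 ∧ w2t b t - w2b b t 0 =
      2 * (t - (cpar b t 0 + cpar b t 1) / 4) - -cpar b t 1 := by
    rw [w2b, if_pos (by decide), w2t]
    simp only [cpar]
    constructor <;> ring
  have hon : ∀ i, OnGraph L W' (t - (cpar b t 0 + cpar b t 1) / 4) (w2b b t i + w2t b t) →
      w2t b t - w2b b t i =
        2 * (t - (cpar b t 0 + cpar b t 1) / 4) - (w2b b t i + w2t b t) →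
      br (W' *ᵥ ![L.weierstrassP (w2b b t i + w2t b t), 1])
        ![L.weierstrassP (w2t b t - w2b b t i), 1] = 0 := fun i hi he => by
    rwa [OnGraph, ← he, wpVec_of_notMem (H'.add_notMem i), wpVec_of_notMem (H'.sub_notMem i)] at hi
  have hW'x : ∀ z, Det1 L (w2b b t) (w2t b t) x z ↔ br (W' *ᵥ hom x) (hom z) = 0 := fun z => by
    refine form_eq_zero_iff_br H'.oddPts_injective.1 H'.oddPts_injective.2 hW' (fun i => ?_) x z
    fin_cases i
    · exact hon 0 (by rw [hk₀.1]; exact hneg) (by rw [hk₀.1, hk₀.2])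
    · exact hon 2 (by
        rw [(hk 2 (by decide)).1]
        exact (hu _ (H.cpar.br_ne_zero (by decide)) (H.cpar.br_ne_zero (by decide))).mp
          ((hWκ 2).mpr (by decide))) (by rw [(hk 2 (by decide)).1, (hk 2 (by decide)).2])
    · exact hon 4 (by
        rw [(hk 4 (by decide)).1]
        exact (hu _ (H.cpar.br_ne_zero (by decide)) (H.cpar.br_ne_zero (by decide))).mp
          ((hWκ 4).mpr (by decide))) (by rw [(hk 4 (by decide)).1, (hk 4 (by decide)).2])
  have hx₀' : br (hom x) (wpVec L (cpar b t 0)) ≠ 0 := fun h => hx₀ (by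
    rwa [← hom_weierstrassP hM.k₁, br_hom_eq_zero_iff] at h)
  have hx₁' : br (hom x) (wpVec L (cpar b t 1)) ≠ 0 := fun h => hx₁ (by
    rwa [← hom_weierstrassP hM.k₂, br_hom_eq_zero_iff] at h)
  have hdet := hM.det_ne_zero hx₀' hx₁'
  rw [mobiusMap_iff hdet, br_eq_zero_comm] at hy
  rw [hW'x, det1_iff_startPts_cpar, hWp, br_eq_zero_comm (w := hom y'),
    br_eq_zero_congr (hom_ne_zero y') (mulVec_ne_zero hdet (hom_ne_zero y)) hy, br_eq_zero_comm]
  have hmul := br_mulVec (M L x (cpar b t 0) (cpar b t 1) t) (W *ᵥ hom x) (hom y)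
  rw [hMW, br_smul_left] at hmul
  have hcx := mul_ne_zero hc hx₀'
  constructor
  · intro h
    rw [br_eq_zero_comm] at h ⊢
    rw [h, mul_zero] at hmul
    exact (mul_eq_zero.mp hmul).resolve_left hcx
  · intro h
    rw [br_eq_zero_comm] at h ⊢
    rw [h, mul_zero] at hmul
    exact (mul_eq_zero.mp hmul.symm).resolve_left hdet

/-- Both sides are equivalent to the second determinant equation for `x` and `y'` at time `t`: one
by the chain for `c` at `t`, the other by the chain for `d` at `t + λ`. -/
theorem det1_translation_iff (H : GeneralPosition L b t) (H₁ : GeneralPosition L b (t + lam b))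
    (hc : ChainRegular L (cpar b t) t)
    (hd : ChainRegular L (dpar b (t + lam b)) (t + lam b)) (hb : b 0 + b 2 + b 4 + b 6 = 0)
    {x y x' y' : OnePoint ℂ} (hx : ∀ i, x ≠ (L.weierstrassP (b i + t) : OnePoint ℂ))
    (hy' : ∀ i, y' ≠ (L.weierstrassP (t + lam b - b i) : OnePoint ℂ))
    (h₁ : Eq1 L b t x y y') (h₂ : Eq2 L b (t + lam b) x' y' x) :
    Det1 L b t x y ↔ Det1 L b (t + lam b) x' y' := by
  have H₂ : GeneralPosition L b (t + lam b - lam b) := by rwa [add_sub_cancel_right]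
  rw [det1_iff_startPts_cpar,
    form_startPts_iff_form_endPts H.cpar H₁.cpar_end hc (cpar_sum hb) hx h₁,
    det1_iff_startPts_dpar,
    form_startPts_iff_form_endPts H₁.dpar H₂.dpar_end hd (dpar_sum hb) hy' h₂,
    ← det2_iff_endPts_cpar, ← det2_iff_endPts_dpar, add_sub_cancel_right]

end EllipticPainleve

end

theorem theorem1 (L : PeriodPair) (b : Fin 8 → ℂ) (T : Set ℂ)
    (hT : ∀ t ∈ T, t + lam b ∈ T ∧ t - lam b ∈ T)
    (hgen : ∀ t ∈ T, GeneralPosition L b t) :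
    -- both determinant equations are Möbius relations
    (∀ t ∈ T, (Fmat L b t).det ≠ 0 ∧ (Gmat L b t).det ≠ 0 ∧
      (∀ x y, Det1 L b t x y ↔ MobiusMap (Fmat L b t) y x) ∧
      (∀ x y', Det2 L b t x y' ↔ MobiusMap (Gmat L b t) x y')) ∧
    -- the solutions of the system are written by the solutions of a linear equation
    (lam b ≠ 0 → ∀ f g : ℂ → OnePoint ℂ, IsDetSolution L b T f g ↔
      ∃ v : ℂ → Fin 2 → ℂ,
        (∀ t ∈ T, v (t + lam b) = (Gmat L b t * Fmat L b t).mulVec (v t)) ∧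
        ∀ t ∈ T, Represents (v t) (g t) ∧ MobiusMap (Fmat L b t) (g t) (f t)) ∧
    (b 0 + b 2 + b 4 + b 6 = 0 →
      -- a solution of the system is a solution of the discrete Painlevé equation
      ((∀ t ∈ T, ChainRegular L (cpar b t) t ∧ ChainRegular L (dpar b t) t) →
        ∀ f g : ℂ → OnePoint ℂ, IsDetSolution L b T f g → IsSolution L b T f g) ∧
      -- of the eight points, the curve `I = 0` contains exactly `p₁`, `p₃`, `p₅`, `p₇`
      (∀ t ∈ T, ChainRegular L (cpar b t) t → ∀ i,
        Det1 L b t ((pt L b t t i).1 : OnePoint ℂ) ((pt L b t t i).2 : OnePoint ℂ) ↔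
          (i = 0 ∨ i = 2 ∨ i = 4 ∨ i = 6)) ∧
      -- the curve `I = 0` is preserved by `w₂`
      (∀ t ∈ T, MRegular L (cpar b t 0) (cpar b t 1) t →
        GeneralPosition L (w2b b t) (w2t b t) →
        ∀ x y y' : OnePoint ℂ,
          x ≠ (L.weierstrassP (cpar b t 0) : OnePoint ℂ) →
          x ≠ (L.weierstrassP (cpar b t 1) : OnePoint ℂ) →
          MobiusMap (M L x (cpar b t 0) (cpar b t 1) t) y y' →
          (Det1 L b t x y ↔ Det1 L (w2b b t) (w2t b t) x y')) ∧
      -- the curve `I = 0` is preserved by the translation `t ↦ t + λ`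
      (∀ t ∈ T, ChainRegular L (cpar b t) t →
        ChainRegular L (dpar b (t + lam b)) (t + lam b) →
        ∀ x y x' y' : OnePoint ℂ,
          (∀ i, x ≠ (L.weierstrassP (b i + t) : OnePoint ℂ)) →
          (∀ i, y' ≠ (L.weierstrassP (t + lam b - b i) : OnePoint ℂ)) →
          Eq1 L b t x y y' → Eq2 L b (t + lam b) x' y' x →
          (Det1 L b t x y ↔ Det1 L b (t + lam b) x' y'))) := by
  have hF : ∀ t ∈ T, (Fmat L b t).det ≠ 0 := fun t ht =>
    det_solveX_ne_zero (hgen t ht).oddPts_injective.1 (hgen t ht).oddPts_injective.2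
  have hinj := fun t ht => (hgen t ht).evenPts_injective (hgen _ (hT t ht).1)
  have hG : ∀ t ∈ T, (Gmat L b t).det ≠ 0 := fun t ht =>
    det_solveY_ne_zero (hinj t ht).1 (hinj t ht).2
  have h₁ : ∀ t ∈ T, ∀ x y, Det1 L b t x y ↔ MobiusMap (Fmat L b t) y x := fun t ht =>
    form_eq_zero_iff_mobiusMap_solveX (hgen t ht).oddPts_injective.1 (hgen t ht).oddPts_injective.2
  have h₂ : ∀ t ∈ T, ∀ x y, Det2 L b t x y ↔ MobiusMap (Gmat L b t) x y := fun t ht =>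
    form_eq_zero_iff_mobiusMap_solveY (hinj t ht).1 (hinj t ht).2
  refine ⟨fun t ht => ⟨hF t ht, hG t ht, h₁ t ht, h₂ t ht⟩,
    fun hl f g => isDetSolution_iff_linear (fun t ht => (hT t ht).1) h₁ h₂ hl f g,
    fun hb => ⟨fun hreg f g hfg t ht hbase => ?_, fun t ht hc i => ?_,
      fun t ht hM H' x y y' hx₀ hx₁ hy => det1_w2_iff (hgen t ht) hM H' hb hx₀ hx₁ hy,
      fun t ht hc hd x y x' y' hx hy' e₁ e₂ => det1_translation_iff (hgen t ht)
        (hgen _ (hT t ht).1) hc hd hb hx hy' e₁ e₂⟩⟩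
  -- The equation for `f(t - λ)` comes from the second determinant equation at the preceding time,
  -- which relates it to `g(t)`.
  · have h₃ := (hfg _ (hT t ht).2).2
    rw [sub_add_cancel] at h₃
    exact eq1_and_eq2_of_det (hgen t ht) (hgen _ (hT t ht).1) (hgen _ (hT t ht).2) (hreg t ht).1
      (hreg t ht).2 hb hbase (hfg t ht).1 (hfg t ht).2 h₃
  · have h := (hgen t ht).cpar.form_startPts_iff hc.four_mul_notMem (cpar_sum hb) i
    rw [two_mul_sub_cpar, ← det1_iff_startPts_cpar] at h
    exact h
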